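/- Let $X$ be a computable perfect Polish space: a complete metric space $(X,d)$ without isolated points together with a dense sequence $\alpha:\mathbb N\to X$ such that $(n,m)\mapsto d(\alpha(n),\alpha(m))$ is a computable double sequence of real numbers. Points of $X$ are represented by Cauchy names: $p\in\mathbb N^{\mathbb N}$ is a name of $x$ if $\alpha(p(n))\to x$ and $d(\alpha(p(n)),\alpha(p(k)))<2^{-k}$ for all $n\ge k$. Sequences are represented by the sequences of names of their members (coded into one element of $\mathbb N^{\mathbb N}$ by a computable pairing function). Let $\mathcal A_-(X)$ be the set of closed subsets of $X$ represented by negative information: $p$ is a name of $A$ if $A=X\setminus\bigcup_i B_{p(i)}$, where $(B_n)_n$ is a standard enumeration of the open balls with centre in $\operatorname{range}(\alpha)$ and rational radius. Let $\mathcal A_+(X)$ be the set of closed subsets of $X$ represented by positive information: let $X\sqcup\{\infty\}$ be $X$ with an additional isolated point $\infty$ at distance $1$ from every point of $X$, with the dense sequence $\infty,\alpha(0),\alpha(1),\dots$ and the corresponding Cauchy names; $p$ is a name of $A$ if $p$ is a name of a sequence $(x_n)_n$ in $X\sqcup\{\infty\}$ with $\overline{\{x_n:n\in\mathbb N\}}\cap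 X=A$. Let $\mathrm{BCT}_{0,X}:\subseteq\mathcal A_-(X)^{\mathbb N}\rightrightarrows X$ and $\mathrm{BCT}_{2,X}:\subseteq\mathcal A_+(X)^{\mathbb N}\rightrightarrows X$ be the multi-valued functions whose domain consists of all sequences $(A_i)_i$ of closed sets with empty interior and which are given there by $(A_i)_i\mapsto X\setminus\bigcup_i A_i$. Let $\mathrm{DBCT}_{0,X}:\subseteq\mathcal A_-(X)^{\mathbb N}\rightrightarrows X^{\mathbb N}$ and $\mathrm{DBCT}_{2,X}:\subseteq\mathcal A_+(X)^{\mathbb N}\rightrightarrows X^{\mathbb N}$ be the multi-valued functions with the same domains which map $(A_i)_i$ to the set of all sequences $(x_j)_j$ of points of $X\setminus\bigcup_i A_i$ that are dense in $X\setminus\bigcup_i A_i$. A partial function $F$ on $\mathbb N^{\mathbb N}$ is a realizer of a multi-valued function $f$ on represented spaces, $F\vdash f$, if $F$ maps every name of every $x\in\operatorname{dom}(f)$ to a name of some $y\in f(x)$. One writes $f\leq_{\mathrm{sW}}g$ (strong Weihrauch reducibility) if there are computable partial functions $H,K$ on $\mathbb N^{\mathbb N}$ such that $H\circ G\circ K\vdash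 f$ for all $G\vdash g$, and $f\equiv_{\mathrm{sW}}g$ if $f\leq_{\mathrm{sW}}g$ and $g\leq_{\mathrm{sW}}f$. Then $$\mathrm{DBCT}_{i,X}\equiv_{\mathrm{sW}}\mathrm{BCT}_{i,X}\qquad\text{for } i=0 \text{ and } i=2.$$ -/

import Mathlib

namespace BaireWeihrauch

open Filter Topology TopologicalSpace

/-! ### Computable functions on Baire space and represented spaces -/

/-- The finite prefix `p(0) p(1) ... p(k-1)` of an infinite sequence. -/
def pre (p : ℕ → ℕ) (k : ℕ) : List ℕ := (List.range k).map p

/-- A partial function `F` on Baire space is computable if a machine transforms every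
`p` in the domain of `F`, symbol by symbol, into `F p` written on a one-way output tape.
The machine is given by the computable monotone word function `h`, where `h w` is the output
that is written once the finite input `w` has been processed. The domain of `F` consists of exactly
those inputs `p` on which the output becomes infinite, and `F p` is then this infinite output. -/
def IsComputable (F : (ℕ → ℕ) →. (ℕ → ℕ)) : Prop :=
  ∃ h : List ℕ → List ℕ, Computable h ∧ (∀ u v : List ℕ, u <+: v → h u <+: h v) ∧
    ∀ p q : ℕ → ℕ, q ∈ F p ↔ ∀ n : ℕ, ∃ k : ℕ, (h (pre p k))[n]? = some (q n)

/-- A representation of `X`: a partial surjective map from Baire space onto `X`, given by its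
graph. `names p x` says that `p` is in the domain and that `p` is a name of `x`. -/
structure Representation (X : Type*) where
  names : (ℕ → ℕ) → X → Prop
  unique : ∀ p x y, names p x → names p y → x = y
  surj : ∀ x, ∃ p, names p x

/-- The representation of sequences: `p = ⟨p₀, p₁, ...⟩`, with `p ⟨i, j⟩ = pᵢ j`, is a name of
`(xᵢ)ᵢ` if every `pᵢ` is a name of `xᵢ`. -/
def Representation.seq {X : Type*} (δ : Representation X) : Representation (ℕ → X) where
  names p x := ∀ i, δ.names (fun j => p (Nat.pair i j)) (x i)
  unique p x y hx hy := funext fun i => δ.unique _ _ _ (hx i) (hy i)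
  surj x := by
    choose q hq using fun i => δ.surj (x i)
    exact ⟨fun n => q n.unpair.1 n.unpair.2, fun i => by simpa using hq i⟩

/-- A partial multi-valued function `f : ⊆ X ⇉ Y` on represented spaces: it has the domain `dom`
and `val x` is the set of possible values on `x ∈ dom`. -/
structure Problem (X Y : Type*) where
  inRep : Representation X
  outRep : Representation Y
  dom : Set X
  val : X → Set Y

/-- `F` is a realizer of `f`: it is defined on every name `p` of a point `x` in the domain of `f`,
and maps it to a name of some value in `f x`. -/
def Realizes {X Y : Type*} (F : (ℕ → ℕ) →. (ℕ → ℕ)) (f : Problem X Y) : Prop :=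
  ∀ p x, f.inRep.names p x → x ∈ f.dom →
    ∃ q ∈ F p, ∃ y ∈ f.val x, f.outRep.names q y

/-- Strong Weihrauch reducibility. -/
def StrongReducible {X Y U V : Type*} (f : Problem X Y) (g : Problem U V) : Prop :=
  ∃ K H : (ℕ → ℕ) →. (ℕ → ℕ), IsComputable K ∧ IsComputable H ∧
    ∀ G : (ℕ → ℕ) →. (ℕ → ℕ), Realizes G g → Realizes (H.comp (G.comp K)) f

/-- Strong Weihrauch equivalence. -/
def StrongEquiv {X Y U V : Type*} (f : Problem X Y) (g : Problem U V) : Prop :=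
  StrongReducible f g ∧ StrongReducible g f

/-! ### Computable metric spaces -/

/-- The standard enumeration of the rational numbers, `⟨⟨a, b⟩, c⟩ ↦ (a - b) / (c + 1)`. -/
def ratEnum (n : ℕ) : ℚ :=
  ((n.unpair.1.unpair.1 : ℚ) - (n.unpair.1.unpair.2 : ℚ)) / ((n.unpair.2 : ℚ) + 1)

/-- The structure of a computable metric space on `X`: a dense sequence `α` such that the
distances `d (α n) (α m)` form a computable double sequence of real numbers. -/
structure ComputableMetric (X : Type*) [MetricSpace X] where
  α : ℕ → X
  dense : DenseRange α
  computable_dist : ∃ e : ℕ × ℕ × ℕ → ℕ, Computable e ∧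
    ∀ n m k : ℕ, |dist (α n) (α m) - (ratEnum (e (n, m, k)) : ℝ)| ≤ (1 / 2 : ℝ) ^ k

/-- `p` is a Cauchy name of `y` with respect to a distance `d` and a sequence `β`: the sequence
`β (p n)` converges to `y` and `d (β (p n)) (β (p k)) < 2 ^ (-k)` for all `n ≥ k`. -/
def CauchyName {Y : Type*} (d : Y → Y → ℝ) (β : ℕ → Y) (p : ℕ → ℕ) (y : Y) : Prop :=
  Tendsto (fun n => d (β (p n)) y) atTop (𝓝 0) ∧
    ∀ k n : ℕ, k ≤ n → d (β (p n)) (β (p k)) < (1 / 2 : ℝ) ^ k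

/-- The distance on the coproduct of `X` with a point at infinity, which has distance `1` to every
point of `X`. -/
def coprodDist {X : Type*} [MetricSpace X] : X ⊕ Unit → X ⊕ Unit → ℝ
  | .inl x, .inl y => dist x y
  | .inr _, .inr _ => 0
  | .inl _, .inr _ => 1
  | .inr _, .inl _ => 1

/-- The dense sequence of the coproduct: first the point at infinity, then the sequence `α`. -/
def coprodSeq {X : Type*} (α : ℕ → X) : ℕ → X ⊕ Unit
  | 0 => .inr ()
  | n + 1 => .inl (α n)

theorem exists_cauchyName {X : Type*} [MetricSpace X] {α : ℕ → X} (hα : DenseRange α) (x : X) :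
    ∃ p, CauchyName dist α p x := by
  have h : ∀ n : ℕ, ∃ m, dist x (α m) < (1 / 2 : ℝ) ^ (n + 1) :=
    fun n => hα.exists_dist_lt x (by positivity)
  choose p hp using h
  refine ⟨p, ?_, fun k n hkn => ?_⟩
  · refine squeeze_zero (fun _ => dist_nonneg)
      (fun n => (by rw [dist_comm]; exact (hp n).le :
        dist (α (p n)) x ≤ (1 / 2 : ℝ) ^ (n + 1))) ?_
    exact (tendsto_add_atTop_iff_nat 1).2
      (tendsto_pow_atTop_nhds_zero_of_lt_one (by norm_num) (by norm_num))
  · have h1 : (1 / 2 : ℝ) ^ (n + 1) ≤ (1 / 2 : ℝ) ^ (k + 1) :=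
      pow_le_pow_of_le_one (by norm_num) (by norm_num) (by omega)
    have h2 := dist_triangle_left (α (p n)) (α (p k)) x
    have h3 := hp n
    have h4 := hp k
    have h5 : (1 / 2 : ℝ) ^ (k + 1) = (1 / 2 : ℝ) ^ k / 2 := by ring
    linarith

variable {X : Type*} [MetricSpace X]

/-- The Cauchy representation of `X`. -/
def cauchyRep (S : ComputableMetric X) : Representation X where
  names p x := CauchyName dist S.α p x
  unique _ _ _ hx hy :=
    tendsto_nhds_unique (tendsto_iff_dist_tendsto_zero.2 hx.1)
      (tendsto_iff_dist_tendsto_zero.2 hy.1)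
  surj x := exists_cauchyName S.dense x

theorem coprod_tendsto_unique (u : ℕ → X ⊕ Unit) (x y : X ⊕ Unit)
    (hx : Tendsto (fun n => coprodDist (u n) x) atTop (𝓝 0))
    (hy : Tendsto (fun n => coprodDist (u n) y) atTop (𝓝 0)) : x = y := by
  have ex := fun (ε : ℝ) (hε : 0 < ε) => (hx.eventually (gt_mem_nhds hε)).and
    (hy.eventually (gt_mem_nhds hε))
  rcases x with x | x <;> rcases y with y | y
  · refine congrArg Sum.inl (eq_of_forall_dist_le fun ε hε => ?_)
    obtain ⟨n, h1, h2⟩ := (ex (min (ε / 2) 1) (by positivity)).exists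
    have a := min_le_left (ε / 2) (1 : ℝ)
    have b := min_le_right (ε / 2) (1 : ℝ)
    rcases hu : u n with z | z <;> simp only [hu, coprodDist] at h1 h2
    · have := dist_triangle_left x y z
      linarith
    · linarith
  · obtain ⟨n, h1, h2⟩ := (ex 1 one_pos).exists
    rcases hu : u n with z | z <;> simp [hu, coprodDist] at h1 h2
  · obtain ⟨n, h1, h2⟩ := (ex 1 one_pos).exists
    rcases hu : u n with z | z <;> simp [hu, coprodDist] at h1 h2
  · rfl

/-- The Cauchy representation of the coproduct of `X` with a point at infinity. -/
def coprodRep (S : ComputableMetric X) : Representation (X ⊕ Unit) where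
  names p x := CauchyName coprodDist (coprodSeq S.α) p x
  unique p x y hx hy := coprod_tendsto_unique _ x y hx.1 hy.1
  surj x := by
    rcases x with x | x
    · obtain ⟨p, hp⟩ := exists_cauchyName S.dense x
      exact ⟨fun n => p n + 1, hp⟩
    · refine ⟨fun _ => 0, ?_, fun k n _ => ?_⟩
      · simp [coprodSeq, coprodDist]
      · simp only [coprodSeq, coprodDist]
        positivity

/-! ### Closed sets by negative and by positive information -/

/-- The enumeration of the rational open balls: `⟨n, k⟩ ↦ B(α n, r)` with `r` the `k`-th
rational number. -/
def ratBall (S : ComputableMetric X) (n : ℕ) : Set X :=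
  Metric.ball (S.α n.unpair.1) (ratEnum n.unpair.2 : ℝ)

theorem exists_ratEnum (q : ℚ) : ∃ n, ratEnum n = q := by
  refine ⟨Nat.pair (Nat.pair q.num.toNat (-q.num).toNat) (q.den - 1), ?_⟩
  have h1 : ((q.num.toNat : ℕ) : ℚ) - (((-q.num).toNat : ℕ) : ℚ) = q.num := by
    have : ((q.num.toNat : ℕ) : ℤ) - (((-q.num).toNat : ℕ) : ℤ) = q.num := by omega
    exact_mod_cast this
  have h2 : ((q.den - 1 : ℕ) : ℚ) + 1 = q.den := by
    have := q.den_pos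
    exact_mod_cast (by omega : q.den - 1 + 1 = q.den)
  simp only [ratEnum, Nat.unpair_pair, h1, h2]
  exact q.num_div_den

theorem exists_ratBall (S : ComputableMetric X) {U : Set X} (hU : IsOpen U) {x : X} (hx : x ∈ U) :
    ∃ n, x ∈ ratBall S n ∧ ratBall S n ⊆ U := by
  obtain ⟨ε, hε, hb⟩ := Metric.isOpen_iff.1 hU x hx
  obtain ⟨q, hq0, hq⟩ := exists_rat_btwn (half_pos hε)
  obtain ⟨m, hm⟩ := S.dense.exists_dist_lt x hq0
  obtain ⟨k, hk⟩ := exists_ratEnum q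
  refine ⟨Nat.pair m k, ?_, fun y hy => hb ?_⟩
  · simpa [ratBall, hk] using hm
  · simp only [ratBall, Nat.unpair_pair, hk, Metric.mem_ball] at hy ⊢
    have := dist_triangle_right y x (S.α m)
    linarith

/-- The representation of closed sets by negative information: `p` is a name of the complement of
the union of the rational balls with the numbers `p 0, p 1, ...`. -/
def negRep (S : ComputableMetric X) : Representation (Closeds X) where
  names p A := (A : Set X) = (⋃ i, ratBall S (p i))ᶜ
  unique p A B hA hB := Closeds.ext (hA.trans hB.symm)
  surj A := by
    classical
    refine ⟨fun j => if ratBall S j ⊆ (A : Set X)ᶜ then j else 0, ?_⟩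
    by_cases h0 : ratBall S 0 ⊆ (A : Set X)ᶜ
    · rw [eq_compl_comm]
      refine Set.Subset.antisymm (Set.iUnion_subset fun j => ?_) fun x hx => ?_
      · dsimp only
        split_ifs with h
        · exact h
        · exact h0
      · obtain ⟨n, hn, hs⟩ := exists_ratBall S A.isClosed.isOpen_compl hx
        exact Set.mem_iUnion.2 ⟨n, by simpa only [if_pos hs] using hn⟩
    · refine absurd (fun x hx => ?_) h0
      simp [ratBall, ratEnum] at hx

/-- The representation of closed sets by positive information: `p` is a name of `A` if it is a
name of a sequence `(xₙ)` in the coproduct of `X` with a point at infinity such that the closure of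
`{xₙ : n ∈ ℕ}`, intersected with `X`, is `A`. -/
def posRep (S : ComputableMetric X) : Representation (Closeds X) where
  names p A := ∃ x : ℕ → X ⊕ Unit, (coprodRep S).seq.names p x ∧
    (A : Set X) = Sum.inl ⁻¹' closure (Set.range x)
  unique p A B hA hB := by
    obtain ⟨x, hx, hA⟩ := hA
    obtain ⟨y, hy, hB⟩ := hB
    obtain rfl := (coprodRep S).seq.unique p x y hx hy
    exact Closeds.ext (hA.trans hB.symm)
  surj A := by
    have key : ∃ x : ℕ → X ⊕ Unit, (A : Set X) = Sum.inl ⁻¹' closure (Set.range x) := by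
      rcases (A : Set X).eq_empty_or_nonempty with h | h
      · refine ⟨fun _ => .inr (), ?_⟩
        rw [h, Set.range_const, closure_singleton]
        ext
        simp
      · have : SeparableSpace X := ⟨_, Set.countable_range S.α, S.dense⟩
        have : SecondCountableTopology X := UniformSpace.secondCountable_of_separable X
        have : Nonempty A := h.to_subtype
        let u := denseSeq A
        refine ⟨fun n => .inl (u n : X), ?_⟩
        have hr : Set.range (fun n => (Sum.inl (u n : X) : X ⊕ Unit)) =
            Sum.inl '' Set.range (fun n => (u n : X)) := by
          rw [← Set.range_comp]
          rfl
        rw [hr, IsOpenMap.preimage_closure_eq_closure_preimage isOpenMap_inl continuous_inl,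
          Set.preimage_image_eq _ Sum.inl_injective]
        refine Set.Subset.antisymm (fun x hx => ?_)
          (closure_minimal (by rintro _ ⟨n, rfl⟩; exact (u n).2) A.isClosed)
        have := image_closure_subset_closure_image (s := Set.range u) continuous_subtype_val
          ⟨⟨x, hx⟩, denseRange_denseSeq A _, rfl⟩
        rwa [← Set.range_comp] at this
    obtain ⟨x, hx⟩ := key
    obtain ⟨p, hp⟩ := (coprodRep S).seq.surj x
    exact ⟨p, x, hp, hx⟩

/-! ### The Baire Category Theorem as a problem -/

/-- The sequences of closed sets with empty interior. -/
def nowhereDenseSeqs (X : Type*) [MetricSpace X] : Set (ℕ → Closeds X) :=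
  {A | ∀ i, interior (A i : Set X) = ∅}

/-- The points that lie in none of the given closed sets. -/
def residue (A : ℕ → Closeds X) : Set X := (⋃ i, (A i : Set X))ᶜ

/-- The sequences in the complement of the union of the given closed sets that are dense in this
complement. -/
def denseSeqsIn (A : ℕ → Closeds X) : Set (ℕ → X) :=
  {x | (∀ i, x i ∈ residue A) ∧ residue A ⊆ closure (Set.range x)}

/-- `BCT₀`: closed sets given by negative information, output a point. -/
def BCT0 (S : ComputableMetric X) : Problem (ℕ → Closeds X) X where
  inRep := (negRep S).seq
  outRep := cauchyRep S
  dom := nowhereDenseSeqs X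
  val := residue

/-- `BCT₂`: closed sets given by positive information, output a point. -/
def BCT2 (S : ComputableMetric X) : Problem (ℕ → Closeds X) X where
  inRep := (posRep S).seq
  outRep := cauchyRep S
  dom := nowhereDenseSeqs X
  val := residue

/-- `DBCT₀`: closed sets given by negative information, output a dense sequence. -/
def DBCT0 (S : ComputableMetric X) : Problem (ℕ → Closeds X) (ℕ → X) where
  inRep := (negRep S).seq
  outRep := (cauchyRep S).seq
  dom := nowhereDenseSeqs X
  val := denseSeqsIn

/-- `DBCT₂`: closed sets given by positive information, output a dense sequence. -/
def DBCT2 (S : ComputableMetric X) : Problem (ℕ → Closeds X) (ℕ → X) where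
  inRep := (posRep S).seq
  outRep := (cauchyRep S).seq
  dom := nowhereDenseSeqs X
  val := denseSeqsIn

end BaireWeihrauch

/-!
One direction of each equivalence is immediate: a dense sequence in the complement of the given
sets has a first member. For the other direction the output must be decoded from a point `x` of the
complement of some nowhere dense sets alone, without access to the given sets. The idea is that a
generic point `x` encodes infinitely many freely prescribable numbers, from which one computes a
sequence of points that is generic relative to the given sets.

The numbers are read off as follows. There is a computable real number, `genericRadius`, such that
its quotients by powers of two never occur as a distance between points of the dense sequence `α`
(`below_spec`). Around each `α i` a computable sequence of such radii cuts the space into open rings,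
and each ring between consecutive radii contains some `α n` (`exists_between_ringRadius`); no such
point lies on the boundary of a ring. The `i`-th symbol of `x` is determined by the ring about `α i` in which `x` lies,
and each number is the symbol of infinitely many of these rings. If `α i` is the first point of the
sequence in an open set, then the symbols before the `i`-th are constant near `α i` and the `i`-th
one can be prescribed arbitrarily (`exists_history`).

A sequence of symbols is interpreted, for each `n`, as a sequence of proposals for moving from the
`n`-th basic ball to smaller and smaller balls (`track`); the limits of these tracks form the dense
sequence, and `exists_decoder` computes them from any name of `x`. By `exists_history` and
`exists_ballStep`, every nonempty open set contains a point near which the `n`-th track verifiably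
avoids a given nowhere dense set (`exists_steering`). So it remains to compute a name of a nowhere
dense set outside of which all points have this property (`strongReducible_of_transform`). With
negative information the complement of such a set is enumerated as a union of balls whose verified
tracks enter the complement of the given set. With positive information one lists, for each
precision `s`, the points of a computable net at which the symbols verified with precision `s` are
too few or the ball reached by the track meets the given set. Near a point where the track avoids the
given set, only finitely many of the nets contribute. Since nets are locally finite and `X` is
perfect, the set of all listed points is nowhere dense (`interior_closure_net_eq_empty`).
-/

namespace BaireWeihrauch

open Filter Topology TopologicalSpace

/-! ### Computable functions on discrete types -/

attribute [fun_prop] Computable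
attribute [fun_prop] Computable.id Computable.const Computable.comp Computable.pair

section Computability

variable {α β γ : Type*} [Primcodable α] [Primcodable β] [Primcodable γ]

@[fun_prop]
theorem computable_fst {f : α → β × γ} (hf : Computable f) : Computable fun a => (f a).1 :=
  Computable.fst.comp hf

@[fun_prop]
theorem computable_snd {f : α → β × γ} (hf : Computable f) : Computable fun a => (f a).2 :=
  Computable.snd.comp hf

@[fun_prop]
theorem computable_unpair {f : α → ℕ} (hf : Computable f) :
    Computable fun a => Nat.unpair (f a) :=
  Computable.unpair.comp hf

@[fun_prop]
theorem computable_natPair {f g : α → ℕ} (hf : Computable f) (hg : Computable g) :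
    Computable fun a => Nat.pair (f a) (g a) :=
  Primrec₂.natPair.to_comp.comp hf hg

@[fun_prop]
theorem computable_add {f g : α → ℕ} (hf : Computable f) (hg : Computable g) :
    Computable fun a => f a + g a :=
  Primrec.nat_add.to_comp.comp hf hg

@[fun_prop]
theorem computable_mul {f g : α → ℕ} (hf : Computable f) (hg : Computable g) :
    Computable fun a => f a * g a :=
  Primrec.nat_mul.to_comp.comp hf hg

@[fun_prop]
theorem computable_sub {f g : α → ℕ} (hf : Computable f) (hg : Computable g) :
    Computable fun a => f a - g a :=
  Primrec.nat_sub.to_comp.comp hf hg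

@[fun_prop]
theorem computable_div {f g : α → ℕ} (hf : Computable f) (hg : Computable g) :
    Computable fun a => f a / g a :=
  Primrec.nat_div.to_comp.comp hf hg

@[fun_prop]
theorem computable_pow {f g : α → ℕ} (hf : Computable f) (hg : Computable g) :
    Computable fun a => f a ^ g a :=
  (Primrec₂.unpaired'.1 Nat.Primrec.pow).to_comp.comp hf hg

@[fun_prop]
theorem computable_decide_le {f g : α → ℕ} (hf : Computable f) (hg : Computable g) :
    Computable fun a => decide (f a ≤ g a) :=
  Primrec.nat_le.decide.to_comp.comp hf hg

@[fun_prop]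
theorem computable_decide_lt {f g : α → ℕ} (hf : Computable f) (hg : Computable g) :
    Computable fun a => decide (f a < g a) :=
  Primrec.nat_lt.decide.to_comp.comp hf hg

@[fun_prop]
theorem computable_decide_eq {f g : α → ℕ} (hf : Computable f) (hg : Computable g) :
    Computable fun a => decide (f a = g a) :=
  Primrec.eq.decide.to_comp.comp hf hg

@[fun_prop]
theorem computable_and {f g : α → Bool} (hf : Computable f) (hg : Computable g) :
    Computable fun a => f a && g a :=
  Primrec.and.to_comp.comp hf hg

@[fun_prop]
theorem computable_or {f g : α → Bool} (hf : Computable f) (hg : Computable g) :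
    Computable fun a => f a || g a :=
  Primrec.or.to_comp.comp hf hg

@[fun_prop]
theorem computable_not {f : α → Bool} (hf : Computable f) : Computable fun a => !f a :=
  Primrec.not.to_comp.comp hf

@[fun_prop]
theorem computable_cond {c : α → Bool} {f g : α → β} (hc : Computable c) (hf : Computable f)
    (hg : Computable g) : Computable fun a => bif c a then f a else g a :=
  Computable.cond hc hf hg

@[fun_prop]
theorem computable_length {f : α → List β} (hf : Computable f) :
    Computable fun a => (f a).length :=
  Computable.list_length.comp hf

@[fun_prop]
theorem computable_concat {f : α → List β} {g : α → β} (hf : Computable f) (hg : Computable g) :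
    Computable fun a => f a ++ [g a] :=
  Computable.list_concat.comp hf hg

@[fun_prop]
theorem computable_getElem? {f : α → List β} {g : α → ℕ} (hf : Computable f)
    (hg : Computable g) : Computable fun a => (f a)[g a]? :=
  Computable.list_getElem?.comp hf hg

@[fun_prop]
theorem computable_getD {f : α → List ℕ} {g : α → ℕ} (d : ℕ) (hf : Computable f)
    (hg : Computable g) : Computable fun a => (f a).getD (g a) d :=
  (Primrec.list_getD d).to_comp.comp hf hg

@[fun_prop]
theorem computable_some {f : α → β} (hf : Computable f) : Computable fun a => some (f a) :=
  Computable.option_some.comp hf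

@[fun_prop]
theorem computable_isSome {f : α → Option β} (hf : Computable f) :
    Computable fun a => (f a).isSome :=
  Primrec.option_isSome.to_comp.comp hf

theorem computable_optionElim {o : α → Option β} {f : α → γ} {g : α → β → γ} (ho : Computable o)
    (hf : Computable f) (hg : Computable fun q : α × β => g q.1 q.2) :
    Computable fun a => (o a).elim (f a) (g a) :=
  (Computable.option_casesOn ho hf hg).of_eq fun a => by cases o a <;> rfl

theorem computable_optionMap {o : α → Option β} {g : α → β → γ} (ho : Computable o)
    (hg : Computable fun q : α × β => g q.1 q.2) : Computable fun a => (o a).map (g a) :=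
  Computable.option_map ho hg

theorem computable_natRec {f : α → ℕ} {g : α → β} {h : α → ℕ → β → β} (hf : Computable f)
    (hg : Computable g) (hh : Computable fun q : α × ℕ × β => h q.1 q.2.1 q.2.2) :
    Computable fun a => (Nat.rec (g a) (h a) (f a) : β) :=
  Computable.nat_rec (h := fun a q => h a q.1 q.2) hf hg hh

theorem computable_find {P : α → ℕ → Bool} (hP : Computable fun q : α × ℕ => P q.1 q.2)
    (h : ∀ a, ∃ n, P a n = true) : Computable fun a => Nat.find (h a) := by
  have h1 : Partrec fun a => Nat.rfind (P a : ℕ →. Bool) :=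
    Partrec.rfind (p := fun a => (P a : ℕ →. Bool)) hP.to₂.partrec₂
  refine h1.of_eq_tot fun a => Nat.mem_rfind.2 ⟨?_, fun {m} hm => ?_⟩
  · simpa using Nat.find_spec (h a)
  · simpa using Nat.find_min (h a) hm

end Computability

/-- The first `n < b` with `P n`, if there is one. -/
def firstBelow (P : ℕ → Bool) : ℕ → Option ℕ
  | 0 => none
  | b + 1 => (firstBelow P b).elim (bif P b then some b else none) some

theorem firstBelow_eq_some {P : ℕ → Bool} {b n : ℕ} :
    firstBelow P b = some n ↔ n < b ∧ P n = true ∧ ∀ m < n, P m = false := by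
  have key : ∀ b, (∀ n, firstBelow P b = some n → n < b ∧ P n = true ∧ ∀ m < n, P m = false) ∧
      (firstBelow P b = none → ∀ m < b, P m = false) := by
    intro b
    induction b with
    | zero => simp [firstBelow]
    | succ b ih =>
      cases hb : firstBelow P b with
      | some k =>
        have := ih.1 k hb
        simp only [firstBelow, hb, Option.elim]
        refine ⟨fun n hn => ?_, fun h => by simp at h⟩
        obtain rfl : k = n := by simpa using hn
        exact ⟨by omega, this.2⟩
      | none =>
        have := ih.2 hb
        cases hP : P b with
        | true =>
          simp only [firstBelow, hb, Option.elim, hP, cond_true]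
          refine ⟨fun n hn => ?_, fun h => by simp at h⟩
          obtain rfl : b = n := by simpa using hn
          exact ⟨by omega, hP, this⟩
        | false =>
          simp only [firstBelow, hb, Option.elim, hP, cond_false]
          refine ⟨fun n hn => by simp at hn, fun _ m hm => ?_⟩
          rcases Nat.lt_succ_iff_lt_or_eq.1 hm with h | rfl
          exacts [this m h, hP]
  refine ⟨(key b).1 n, fun ⟨h1, h2, h3⟩ => ?_⟩
  cases hb : firstBelow P b with
  | none => simp [(key b).2 hb n h1] at h2
  | some k =>
    obtain ⟨-, h5, h6⟩ := (key b).1 k hb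
    rcases lt_trichotomy k n with h | h | h
    · simp [h3 k h] at h5
    · rw [h]
    · simp [h6 n h] at h2

theorem firstBelow_isSome {P : ℕ → Bool} {b : ℕ} :
    (firstBelow P b).isSome = true ↔ ∃ n < b, P n = true := by
  constructor
  · intro h
    obtain ⟨n, hn⟩ := Option.isSome_iff_exists.1 h
    obtain ⟨h1, h2, -⟩ := firstBelow_eq_some.1 hn
    exact ⟨n, h1, h2⟩
  · intro h
    obtain ⟨h1, h2⟩ := Nat.find_spec h
    exact Option.isSome_iff_exists.2 ⟨Nat.find h, firstBelow_eq_some.2 ⟨h1, h2, fun m hm => by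
      have := Nat.find_min h hm
      simp only [not_and, Bool.not_eq_true] at this
      exact this (by omega)⟩⟩

theorem computable_firstBelow {α : Type*} [Primcodable α] {P : α → ℕ → Bool} {f : α → ℕ}
    (hP : Computable fun q : α × ℕ => P q.1 q.2) (hf : Computable f) :
    Computable fun a => firstBelow (P a) (f a) := by
  have h : Computable fun a => (Nat.rec (none : Option ℕ) (fun b (r : Option ℕ) =>
      r.elim (bif P a b then some b else none) some) (f a) : Option ℕ) := by
    refine computable_natRec hf (by fun_prop)
      (h := fun a b (r : Option ℕ) => r.elim (bif P a b then some b else none) some)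
      (computable_optionElim (by fun_prop) ?_ (by fun_prop))
    have : Computable fun q : α × ℕ × Option ℕ => P q.1 q.2.1 :=
      hP.comp (g := fun q : α × ℕ × Option ℕ => (q.1, q.2.1)) (by fun_prop)
    fun_prop
  refine h.of_eq fun a => ?_
  induction f a with
  | zero => rfl
  | succ b ih => simp only [firstBelow, ← ih]

/-- The longest list of consecutive values `o 0, o 1, ...` of a partial function that are
defined, cut off at length `b`. -/
def grow (o : ℕ → Option ℕ) : ℕ → List ℕ
  | 0 => []
  | b + 1 => (o (grow o b).length).elim (grow o b) fun a => grow o b ++ [a]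

theorem length_grow_le (o : ℕ → Option ℕ) (b : ℕ) : (grow o b).length ≤ b := by
  induction b with
  | zero => simp [grow]
  | succ b ih => cases h : o (grow o b).length <;> simp [grow, h] <;> omega

theorem grow_spec {o : ℕ → Option ℕ} {b i : ℕ} (hi : i < (grow o b).length) :
    o i = some (grow o b)[i] := by
  induction b with
  | zero => simp [grow] at hi
  | succ b ih =>
    cases h : o (grow o b).length with
    | none =>
      simp only [grow, h, Option.elim] at hi ⊢
      exact ih hi
    | some a =>
      simp only [grow, h, Option.elim, List.length_append, List.length_singleton] at hi ⊢
      rcases Nat.lt_succ_iff_lt_or_eq.1 hi with h1 | rfl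
      · rw [List.getElem_append_left h1]
        exact ih h1
      · simpa using h

theorem le_length_grow {o : ℕ → Option ℕ} {t b : ℕ} (ht : ∀ i < t, (o i).isSome) (htb : t ≤ b) :
    t ≤ (grow o b).length := by
  have key : ∀ b, min t b ≤ (grow o b).length := by
    intro b
    induction b with
    | zero => simp
    | succ b ih =>
      cases h : o (grow o b).length with
      | none =>
        have : t ≤ (grow o b).length := by
          by_contra hlt
          simpa [h] using ht _ (not_le.1 hlt)
        simp [grow, h]
        omega
      | some a =>
        simp [grow, h]
        omega
  simpa [htb] using key b

theorem prefix_grow {o : ℕ → Option ℕ} {l : List ℕ} {b : ℕ}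
    (h : ∀ (i : ℕ) (hi : i < l.length), o i = some l[i]) (hl : l.length ≤ b) : l <+: grow o b := by
  have hlen : l.length ≤ (grow o b).length :=
    le_length_grow (fun i hi => by simp [h i hi]) hl
  refine List.prefix_iff_getElem.2 ⟨hlen, fun i hi => ?_⟩
  have h1 := h i hi
  have h2 := grow_spec (o := o) (b := b) (lt_of_lt_of_le hi hlen)
  rw [h1] at h2
  simpa using h2

theorem computable_grow {α : Type*} [Primcodable α] {o : α → ℕ → Option ℕ} {f : α → ℕ}
    (ho : Computable fun q : α × ℕ => o q.1 q.2) (hf : Computable f) :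
    Computable fun a => grow (o a) (f a) := by
  have h : Computable fun a => (Nat.rec ([] : List ℕ) (fun _ (r : List ℕ) =>
      (o a r.length).elim r fun c => r ++ [c]) (f a) : List ℕ) := by
    refine computable_natRec hf (by fun_prop)
      (h := fun a _ (r : List ℕ) => (o a r.length).elim r fun c => r ++ [c])
      (computable_optionElim ?_ (by fun_prop) (by fun_prop))
    exact ho.comp (g := fun q : α × ℕ × List ℕ => (q.1, q.2.2.length)) (by fun_prop)
  refine h.of_eq fun a => ?_
  induction f a with
  | zero => rfl
  | succ b ih => simp only [grow, ← ih]

/-! ### Computable functions on Baire space -/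

theorem pre_length (p : ℕ → ℕ) (k : ℕ) : (pre p k).length = k := by simp [pre]

theorem pre_getElem? (p : ℕ → ℕ) {k i : ℕ} (h : i < k) : (pre p k)[i]? = some (p i) := by
  simp [pre, h]

theorem pre_getD (p : ℕ → ℕ) {k i : ℕ} (h : i < k) : (pre p k).getD i 0 = p i := by
  simp [List.getD_eq_getElem?_getD, pre_getElem? p h]

theorem pre_prefix (p : ℕ → ℕ) {k m : ℕ} (h : k ≤ m) : pre p k <+: pre p m := by
  refine List.prefix_iff_getElem.2 ⟨by simpa [pre_length], fun i hi => ?_⟩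
  simp [pre]

/-- The partial function on Baire space that is computed by the word function `h`: its values are
the infinite outputs of `h`. -/
noncomputable def machine (h : List ℕ → List ℕ) : (ℕ → ℕ) →. (ℕ → ℕ) := fun p =>
  ⟨∃ q : ℕ → ℕ, ∀ n, ∃ k, (h (pre p k))[n]? = some (q n), fun hq => hq.choose⟩

theorem mem_machine {h : List ℕ → List ℕ} (mono : ∀ u v : List ℕ, u <+: v → h u <+: h v)
    (p q : ℕ → ℕ) : q ∈ machine h p ↔ ∀ n, ∃ k, (h (pre p k))[n]? = some (q n) := by
  constructor
  · rintro ⟨hd, rfl⟩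
    exact hd.choose_spec
  · intro hq
    have hd : ∃ q : ℕ → ℕ, ∀ n, ∃ k, (h (pre p k))[n]? = some (q n) := ⟨q, hq⟩
    refine ⟨hd, funext fun n => ?_⟩
    obtain ⟨k, hk⟩ := hd.choose_spec n
    obtain ⟨m, hm⟩ := hq n
    have ext : ∀ {i j : ℕ} {a : ℕ}, i ≤ j → (h (pre p i))[n]? = some a →
        (h (pre p j))[n]? = some a := by
      intro i j a hij ha
      obtain ⟨t, ht⟩ := mono _ _ (pre_prefix p hij)
      obtain ⟨hlt, -⟩ := List.getElem?_eq_some_iff.1 ha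
      rw [← ht, List.getElem?_append_left hlt, ha]
    have h1 := ext (le_max_left k m) hk
    have h2 := ext (le_max_right k m) hm
    rw [h1] at h2
    exact Option.some.inj h2

/-- To compute a partial function on Baire space it suffices to compute each output symbol from
a sufficiently long prefix of the input, in a way that is stable under prolonging the prefix. -/
theorem exists_isComputable {o : List ℕ → ℕ → Option ℕ}
    (ho : Computable fun q : List ℕ × ℕ => o q.1 q.2)
    (mono : ∀ u v n a, u <+: v → o u n = some a → o v n = some a) :
    ∃ F : (ℕ → ℕ) →. (ℕ → ℕ), IsComputable F ∧
      ∀ p q : ℕ → ℕ, (∀ n, ∃ k, o (pre p k) n = some (q n)) → q ∈ F p := by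
  have hm : ∀ u v : List ℕ, u <+: v → grow (o u) u.length <+: grow (o v) v.length :=
    fun u v huv => prefix_grow (fun i hi => mono u v i _ huv (grow_spec hi))
      ((length_grow_le _ _).trans huv.length_le)
  refine ⟨machine fun w => grow (o w) w.length,
    ⟨_, computable_grow ho (by fun_prop), hm, mem_machine hm⟩,
    fun p q hq => (mem_machine hm p q).2 fun n => ?_⟩
  choose k hk using hq
  let m := max (n + 1) ((Finset.range (n + 1)).sup k)
  have hv : ∀ i < n + 1, o (pre p m) i = some (q i) := fun i hi =>
    mono _ _ _ _ (pre_prefix p ((Finset.le_sup (f := k) (Finset.mem_range.2 hi)).trans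
      (le_max_right _ _))) (hk i)
  have hlen : n + 1 ≤ (grow (o (pre p m)) (pre p m).length).length :=
    le_length_grow (fun i hi => by simp [hv i hi]) (by rw [pre_length]; exact le_max_left _ _)
  refine ⟨m, ?_⟩
  have h1 := grow_spec (o := o (pre p m)) (b := (pre p m).length) (i := n) (by omega)
  rw [hv n (by omega)] at h1
  rw [List.getElem?_eq_getElem (by omega), h1]

/-- A function on Baire space each of whose output symbols depends computably on a single
input symbol is computable. -/
theorem exists_isComputable_symbolwise {g : ℕ → ℕ → ℕ} {φ : ℕ → ℕ}
    (hg : Computable fun q : ℕ × ℕ => g q.1 q.2) (hφ : Computable φ) :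
    ∃ F : (ℕ → ℕ) →. (ℕ → ℕ), IsComputable F ∧
      ∀ p : ℕ → ℕ, (fun n => g n (p (φ n))) ∈ F p := by
  have hmono : ∀ (u v : List ℕ) (n a : ℕ), u <+: v →
      (u[φ n]?).map (g n) = some a → (v[φ n]?).map (g n) = some a := by
    rintro u v n a ⟨t, rfl⟩ h
    obtain ⟨b, hb, rfl⟩ := Option.map_eq_some_iff.1 h
    obtain ⟨hlt, -⟩ := List.getElem?_eq_some_iff.1 hb
    simp [List.getElem?_append_left hlt, hb]
  obtain ⟨F, hF, h⟩ := exists_isComputable (o := fun w n => (w[φ n]?).map (g n))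
    (computable_optionMap (by fun_prop)
      (hg.comp (g := fun q : (List ℕ × ℕ) × ℕ => (q.1.2, q.2)) (by fun_prop))) hmono
  exact ⟨F, hF, fun p => h p _ fun n =>
    ⟨φ n + 1, by simp [pre_getElem? p (Nat.lt_succ_self _)]⟩⟩

/-! ### Approximate distances and a generic radius -/

section Generic

variable {X : Type*} [MetricSpace X] (S : ComputableMetric X)

/-- A natural number that approximates `2 ^ z * d (α n, α m)` with error at most `2`. -/
noncomputable def distApprox (n m z : ℕ) : ℕ :=
  ((S.computable_dist.choose (n, m, z)).unpair.1.unpair.1 -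
    (S.computable_dist.choose (n, m, z)).unpair.1.unpair.2) * 2 ^ z /
      ((S.computable_dist.choose (n, m, z)).unpair.2 + 1)

@[fun_prop]
theorem computable_distApprox {β : Type*} [Primcodable β] {f g h : β → ℕ} (hf : Computable f)
    (hg : Computable g) (hh : Computable h) :
    Computable fun a => distApprox S (f a) (g a) (h a) := by
  have he := S.computable_dist.choose_spec.1
  have : Computable fun a => S.computable_dist.choose (f a, g a, h a) := by fun_prop
  unfold distApprox
  fun_prop

theorem abs_dist_sub_distApprox_le (n m z : ℕ) :
    |dist (S.α n) (S.α m) * 2 ^ z - distApprox S n m z| ≤ 2 := by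
  have he := S.computable_dist.choose_spec.2 n m z
  unfold distApprox
  generalize S.computable_dist.choose (n, m, z) = r at he ⊢
  generalize ha : r.unpair.1.unpair.1 = a at he ⊢
  generalize hb : r.unpair.1.unpair.2 = b at he ⊢
  generalize hc : r.unpair.2 = c at he ⊢
  have hd : (0 : ℝ) ≤ dist (S.α n) (S.α m) := dist_nonneg
  generalize dist (S.α n) (S.α m) = d at he hd ⊢
  have hp : (0 : ℝ) < 2 ^ z := by positivity
  have hc0 : (0 : ℝ) < (c : ℝ) + 1 := by positivity
  have hr : ((ratEnum r : ℚ) : ℝ) = ((a : ℝ) - b) / (c + 1) := by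
    simp [ratEnum, ha, hb, hc]
  rw [hr] at he
  have he1 : |d * 2 ^ z - ((a : ℝ) - b) / (c + 1) * 2 ^ z| ≤ 1 := by
    rw [← sub_mul, abs_mul, abs_of_pos hp]
    calc _ ≤ (1 / 2 : ℝ) ^ z * 2 ^ z := by gcongr
      _ = 1 := by rw [← mul_pow]; norm_num
  obtain ⟨he2, he3⟩ := abs_le.1 he1
  rcases le_total a b with hab | hab
  · have : (a : ℝ) ≤ b := by exact_mod_cast hab
    have h0 : ((a : ℝ) - b) / (c + 1) * 2 ^ z ≤ 0 :=
      mul_nonpos_of_nonpos_of_nonneg (div_nonpos_of_nonpos_of_nonneg (by linarith) hc0.le) hp.le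
    have h1 : 0 ≤ d * 2 ^ z := by positivity
    simp only [Nat.sub_eq_zero_of_le hab, zero_mul, Nat.zero_div, Nat.cast_zero, sub_zero]
    rw [abs_of_nonneg h1]
    linarith
  · have hq : ((a : ℝ) - b) / (c + 1) * 2 ^ z = (((a - b) * 2 ^ z : ℕ) : ℝ) / ((c + 1 : ℕ) : ℝ) := by
      push_cast [Nat.cast_sub hab]
      ring
    rw [hq] at he2 he3
    have h1 := Nat.cast_div_le (α := ℝ) (m := (a - b) * 2 ^ z) (n := c + 1)
    have h2 : (((a - b) * 2 ^ z : ℕ) : ℝ) / ((c + 1 : ℕ) : ℝ) <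
        (((a - b) * 2 ^ z / (c + 1) : ℕ) : ℝ) + 1 := by
      rw [div_lt_iff₀ (by positivity)]
      exact_mod_cast Nat.lt_mul_of_div_lt (Nat.lt_succ_self _) (Nat.succ_pos c)
    rw [abs_le]
    constructor <;> linarith

theorem dist_mul_le (n m z : ℕ) :
    dist (S.α n) (S.α m) * 2 ^ z ≤ distApprox S n m z + 2 := by
  have := (abs_le.1 (abs_dist_sub_distApprox_le S n m z)).2
  linarith

theorem distApprox_le (n m z : ℕ) :
    (distApprox S n m z : ℝ) ≤ dist (S.α n) (S.α m) * 2 ^ z + 2 := by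
  have := (abs_le.1 (abs_dist_sub_distApprox_le S n m z)).1
  linarith

/-- Decides approximately whether the `j`-th of the numbers `2 ^ k * d (α n, α i)` lies in the
lower or in the upper half of the interval from `c / 16 ^ j` to `(c + 1) / 16 ^ j`. -/
noncomputable def lowerHalf (j c : ℕ) : Bool :=
  decide (distApprox S j.unpair.1.unpair.1 j.unpair.1.unpair.2 (j.unpair.2 + 4 * (j + 1)) ≤
    16 * c + 7)

/-- The generic radius lies between `cut j / 16 ^ j` and `(cut j + 1) / 16 ^ j`. Every step moves
away from the `j`-th of the numbers `2 ^ k * d (α n, α i)`. -/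
noncomputable def cut : ℕ → ℕ
  | 0 => 1
  | j + 1 => bif lowerHalf S j (cut j) then 16 * cut j + 14 else 16 * cut j + 1

@[fun_prop]
theorem computable_lowerHalf {β : Type*} [Primcodable β] {f g : β → ℕ} (hf : Computable f)
    (hg : Computable g) : Computable fun a => lowerHalf S (f a) (g a) := by
  unfold lowerHalf
  fun_prop

@[fun_prop]
theorem computable_cut {β : Type*} [Primcodable β] {f : β → ℕ} (hf : Computable f) :
    Computable fun a => cut S (f a) := by
  have h : Computable fun a => (Nat.rec 1 (fun j c =>
      bif lowerHalf S j c then 16 * c + 14 else 16 * c + 1) (f a) : ℕ) :=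
    computable_natRec (h := fun _ j c =>
      bif lowerHalf S j c then 16 * c + 14 else 16 * c + 1) hf (by fun_prop) (by fun_prop)
  refine h.of_eq fun a => ?_
  induction f a with
  | zero => rfl
  | succ j ih => simp only [cut, ← ih]

theorem cut_succ_bounds (j : ℕ) :
    16 * cut S j + 1 ≤ cut S (j + 1) ∧ cut S (j + 1) + 2 ≤ 16 * (cut S j + 1) := by
  cases h : lowerHalf S j (cut S j) <;> simp only [cut, h, cond_true, cond_false] <;> omega

theorem cut_div_strictMono : StrictMono fun j => (cut S j : ℝ) / 16 ^ j := by
  refine strictMono_nat_of_lt_succ fun j => ?_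
  have : (16 : ℝ) * cut S j + 1 ≤ cut S (j + 1) := by exact_mod_cast (cut_succ_bounds S j).1
  rw [div_lt_div_iff₀ (by positivity) (by positivity), pow_succ]
  have hp : (0 : ℝ) < 16 ^ j := by positivity
  nlinarith

theorem cut_succ_div_strictAnti : StrictAnti fun j => ((cut S j : ℝ) + 1) / 16 ^ j := by
  refine strictAnti_nat_of_succ_lt fun j => ?_
  have : (cut S (j + 1) : ℝ) + 2 ≤ 16 * (cut S j + 1) := by
    exact_mod_cast (cut_succ_bounds S j).2
  rw [div_lt_div_iff₀ (by positivity) (by positivity), pow_succ]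
  have hp : (0 : ℝ) < 16 ^ j := by positivity
  nlinarith

theorem cut_div_le (i j : ℕ) : (cut S i : ℝ) / 16 ^ i ≤ ((cut S j : ℝ) + 1) / 16 ^ j := by
  have h1 := (cut_div_strictMono S).monotone (le_max_left i j)
  have h2 := (cut_succ_div_strictAnti S).antitone (le_max_right i j)
  refine h1.trans (le_trans ?_ h2)
  gcongr
  linarith

/-- A computable real number that differs from all the numbers `2 ^ k * d (α n, α i)`. -/
noncomputable def genericRadius : ℝ := ⨆ j, (cut S j : ℝ) / 16 ^ j

theorem cut_div_lt_genericRadius (j : ℕ) : (cut S j : ℝ) / 16 ^ j < genericRadius S :=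
  (cut_div_strictMono S (Nat.lt_succ_self j)).trans_le
    (le_ciSup (f := fun j => (cut S j : ℝ) / 16 ^ j)
      ⟨_, by rintro _ ⟨i, rfl⟩; exact cut_div_le S i 0⟩ (j + 1))

theorem genericRadius_lt (j : ℕ) : genericRadius S < ((cut S j : ℝ) + 1) / 16 ^ j :=
  (ciSup_le fun i => cut_div_le S i (j + 1)).trans_lt
    (cut_succ_div_strictAnti S (Nat.lt_succ_self j))

theorem genericRadius_pos : 0 < genericRadius S :=
  lt_of_le_of_lt (by positivity) (cut_div_lt_genericRadius S 0)

theorem tendsto_cut : Tendsto (fun j => (cut S j : ℝ) / 16 ^ j) atTop (𝓝 (genericRadius S)) :=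
  tendsto_atTop_ciSup (cut_div_strictMono S).monotone
    ⟨_, by rintro _ ⟨i, rfl⟩; exact cut_div_le S i 0⟩

theorem tendsto_cut_succ :
    Tendsto (fun j => ((cut S j : ℝ) + 1) / 16 ^ j) atTop (𝓝 (genericRadius S)) := by
  have h : Tendsto (fun j : ℕ => (1 / 16 : ℝ) ^ j) atTop (𝓝 0) :=
    tendsto_pow_atTop_nhds_zero_of_lt_one (by norm_num) (by norm_num)
  have := (tendsto_cut S).add h
  rw [add_zero] at this
  refine this.congr fun j => ?_
  rw [add_div, div_pow, one_pow]

/-- Decides whether `α n` lies in the ball about `α i` with radius `genericRadius / 2 ^ k`. -/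
noncomputable def below (n i k : ℕ) : Bool :=
  lowerHalf S (Nat.pair (Nat.pair n i) k) (cut S (Nat.pair (Nat.pair n i) k))

@[fun_prop]
theorem computable_below {β : Type*} [Primcodable β] {f g h : β → ℕ} (hf : Computable f)
    (hg : Computable g) (hh : Computable h) :
    Computable fun a => below S (f a) (g a) (h a) := by
  unfold below
  fun_prop

theorem below_spec (n i k : ℕ) :
    (below S n i k = true ∧ dist (S.α n) (S.α i) < genericRadius S * (1 / 2) ^ k) ∨
      (below S n i k = false ∧ genericRadius S * (1 / 2) ^ k < dist (S.α n) (S.α i)) := by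
  unfold below
  set j := Nat.pair (Nat.pair n i) k with hj
  have hlow := cut_div_lt_genericRadius S (j + 1)
  have hup := genericRadius_lt S (j + 1)
  have h1 := dist_mul_le S n i (k + 4 * (j + 1))
  have h2 := distApprox_le S n i (k + 4 * (j + 1))
  have hpow : (2 : ℝ) ^ (k + 4 * (j + 1)) = 2 ^ k * 16 ^ (j + 1) := by
    rw [pow_add, pow_mul]; norm_num
  rw [hpow] at h1 h2
  have hp : (0 : ℝ) < 16 ^ (j + 1) := by positivity
  have hk : (0 : ℝ) < 2 ^ k := by positivity
  rw [div_lt_iff₀ hp] at hlow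
  rw [lt_div_iff₀ hp] at hup
  have hhalf : genericRadius S * (1 / 2) ^ k = genericRadius S / 2 ^ k := by
    rw [div_pow, one_pow]; ring
  rw [hhalf]
  cases h : lowerHalf S j (cut S j) with
  | true =>
    refine Or.inl ⟨rfl, ?_⟩
    have hle : distApprox S n i (k + 4 * (j + 1)) ≤ 16 * cut S j + 7 := by
      simpa [lowerHalf, hj] using h
    have hle' : (distApprox S n i (k + 4 * (j + 1)) : ℝ) ≤ 16 * cut S j + 7 := by
      exact_mod_cast hle
    have hc : (cut S (j + 1) : ℝ) = 16 * cut S j + 14 := by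
      simp [cut, h]
    rw [lt_div_iff₀ hk]
    refine lt_of_mul_lt_mul_right ?_ hp.le
    nlinarith
  | false =>
    refine Or.inr ⟨rfl, ?_⟩
    have hle : 16 * cut S j + 7 < distApprox S n i (k + 4 * (j + 1)) := by
      simpa [lowerHalf, hj] using h
    have hle' : (16 * cut S j + 8 : ℝ) ≤ distApprox S n i (k + 4 * (j + 1)) := by
      exact_mod_cast hle
    have hc : (cut S (j + 1) : ℝ) = 16 * cut S j + 1 := by
      simp [cut, h]
    rw [div_lt_iff₀ hk]
    refine lt_of_mul_lt_mul_right ?_ hp.le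
    nlinarith

theorem below_iff {n i k : ℕ} :
    below S n i k = true ↔ dist (S.α n) (S.α i) < genericRadius S * (1 / 2) ^ k := by
  rcases below_spec S n i k with ⟨h1, h2⟩ | ⟨h1, h2⟩
  · exact iff_of_true h1 h2
  · exact iff_of_false (by simp [h1]) h2.le.not_gt

theorem below_eq_false_iff {n i k : ℕ} :
    below S n i k = false ↔ genericRadius S * (1 / 2) ^ k < dist (S.α n) (S.α i) := by
  rcases below_spec S n i k with ⟨h1, h2⟩ | ⟨h1, h2⟩
  · exact iff_of_false (by simp [h1]) h2.le.not_gt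
  · exact iff_of_true h1 h2

theorem tendsto_genericRadius_mul :
    Tendsto (fun k : ℕ => genericRadius S * (1 / 2) ^ k) atTop (𝓝 0) := by
  simpa using (tendsto_pow_atTop_nhds_zero_of_lt_one (r := (1 / 2 : ℝ)) (by norm_num)
    (by norm_num)).const_mul (genericRadius S)

end Generic

/-! ### The rings about the points of the dense sequence -/

section Rings

variable {X : Type*} [MetricSpace X] [PerfectSpace X] (S : ComputableMetric X)

theorem exists_mem_ball_ne {U : Set X} (hU : IsOpen U) (hne : U.Nonempty) {F : Set X}
    (hF : F.Finite) : ∃ n, S.α n ∈ U ∧ S.α n ∉ F := by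
  obtain ⟨x, hx⟩ := hne
  have hinf : U.Infinite := infinite_of_mem_nhds x (hU.mem_nhds hx)
  obtain ⟨y, hyU, hyF⟩ := (hinf.sdiff hF).nonempty
  obtain ⟨n, hn⟩ := S.dense.exists_mem_open (hU.sdiff hF.isClosed) ⟨y, hyU, hyF⟩
  exact ⟨n, hn⟩

theorem exists_ring (i k : ℕ) :
    ∃ u : ℕ, (below S u.unpair.1 i k && !below S u.unpair.1 i u.unpair.2) = true := by
  have hr : 0 < genericRadius S * (1 / 2) ^ k := mul_pos (genericRadius_pos S) (by positivity)
  obtain ⟨n, hn, hni⟩ := exists_mem_ball_ne S (Metric.isOpen_ball (x := S.α i))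
    ⟨_, Metric.mem_ball_self hr⟩ (Set.finite_singleton (S.α i))
  have hpos : 0 < dist (S.α n) (S.α i) := dist_pos.2 hni
  obtain ⟨k', hk'⟩ := ((tendsto_genericRadius_mul S).eventually (gt_mem_nhds hpos)).exists
  refine ⟨Nat.pair n k', ?_⟩
  rw [Nat.unpair_pair, (below_iff S).2 hn, (below_eq_false_iff S).2 hk']
  rfl

/-- Exponents of radii about `α i`, chosen such that every ring between two consecutive radii
contains a point of the dense sequence. -/
noncomputable def ringExp (i : ℕ) : ℕ → ℕ
  | 0 => 0
  | t + 1 => (Nat.find (exists_ring S i (ringExp i t))).unpair.2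

@[fun_prop]
theorem computable_ringExp {β : Type*} [Primcodable β] {f g : β → ℕ} (hf : Computable f)
    (hg : Computable g) : Computable fun a => ringExp S (f a) (g a) := by
  have hfind : Computable fun q : ℕ × ℕ => Nat.find (exists_ring S q.1 q.2) :=
    computable_find (P := fun (q : ℕ × ℕ) u =>
      below S u.unpair.1 q.1 q.2 && !below S u.unpair.1 q.1 u.unpair.2) (by fun_prop) _
  have h : Computable fun a => (Nat.rec 0 (fun _ k =>
      (Nat.find (exists_ring S (f a) k)).unpair.2) (g a) : ℕ) := by
    refine computable_natRec (h := fun a _ k => (Nat.find (exists_ring S (f a) k)).unpair.2)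
      hg (by fun_prop) ?_
    have := hfind.comp (g := fun q : β × ℕ × ℕ => (f q.1, q.2.2)) (by fun_prop)
    exact computable_snd (computable_unpair this)
  refine h.of_eq fun a => ?_
  induction g a with
  | zero => rfl
  | succ t ih => simp only [ringExp, ← ih]

/-- The `t`-th radius about `α i`. -/
noncomputable def ringRadius (i t : ℕ) : ℝ := genericRadius S * (1 / 2) ^ ringExp S i t

theorem exists_between_ringRadius (i t : ℕ) : ∃ n,
    ringRadius S i (t + 1) < dist (S.α n) (S.α i) ∧
      dist (S.α n) (S.α i) < ringRadius S i t := by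
  have h := Nat.find_spec (exists_ring S i (ringExp S i t))
  rw [Bool.and_eq_true, Bool.not_eq_true', below_iff, below_eq_false_iff] at h
  exact ⟨_, h.2, h.1⟩

theorem ringRadius_strictAnti (i : ℕ) : StrictAnti (ringRadius S i) :=
  strictAnti_nat_of_succ_lt fun t => by
    obtain ⟨n, h1, h2⟩ := exists_between_ringRadius S i t
    exact h1.trans h2

theorem ringExp_strictMono (i : ℕ) : StrictMono (ringExp S i) :=
  strictMono_nat_of_lt_succ fun t => by
    have h := ringRadius_strictAnti S i (Nat.lt_succ_self t)
    unfold ringRadius at h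
    exact (pow_lt_pow_iff_right_of_lt_one₀ (by norm_num) (by norm_num)).1
      (lt_of_mul_lt_mul_left h (genericRadius_pos S).le)

theorem tendsto_ringRadius (i : ℕ) : Tendsto (ringRadius S i) atTop (𝓝 0) :=
  (tendsto_genericRadius_mul S).comp (ringExp_strictMono S i).tendsto_atTop

/-- The point `x` lies in the `t`-th ring about `α i`, which is open: beyond the `t`-th radius and
within all earlier ones. -/
def InRing (x : X) (i t : ℕ) : Prop :=
  ringRadius S i t < dist x (S.α i) ∧ ∀ t' < t, dist x (S.α i) < ringRadius S i t'

theorem InRing.unique {x : X} {i t t' : ℕ} (h : InRing S x i t) (h' : InRing S x i t') :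
    t = t' := by
  rcases lt_trichotomy t t' with hlt | rfl | hlt
  · exact absurd (h'.2 t hlt) h.1.not_gt
  · rfl
  · exact absurd (h.2 t' hlt) h'.1.not_gt

theorem isOpen_inRing (i t : ℕ) : IsOpen {x | InRing S x i t} := by
  have h1 : {x | InRing S x i t} = {x | ringRadius S i t < dist x (S.α i)} ∩
      ⋂ t' ∈ {t' | t' < t}, {x | dist x (S.α i) < ringRadius S i t'} := by
    ext x
    simp [InRing]
  rw [h1]
  exact (isOpen_lt continuous_const (by fun_prop)).inter
    ((Set.finite_lt_nat t).isOpen_biInter fun t' _ => isOpen_lt (by fun_prop) continuous_const)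

theorem exists_inRing {n i : ℕ} (h : S.α n ≠ S.α i) : ∃ t, InRing S (S.α n) i t := by
  have hex : ∃ t, ringRadius S i t < dist (S.α n) (S.α i) :=
    ((tendsto_ringRadius S i).eventually (gt_mem_nhds (dist_pos.2 h))).exists
  refine ⟨Nat.find hex, Nat.find_spec hex, fun t' ht' => ?_⟩
  rcases below_spec S n i (ringExp S i t') with h1 | h1
  · exact h1.2
  · exact absurd h1.2 (Nat.find_min hex ht')

/-- The `i`-th symbol of `x`: if `x` lies in the `t`-th ring about `α i`, then the symbol is the
first component of `t`, so that each symbol belongs to infinitely many rings. -/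
def IsSymbol (x : X) (i v : ℕ) : Prop := ∃ t, InRing S x i t ∧ t.unpair.1 = v

theorem IsSymbol.unique {x : X} {i v v' : ℕ} (h : IsSymbol S x i v) (h' : IsSymbol S x i v') :
    v = v' := by
  obtain ⟨t, ht, rfl⟩ := h
  obtain ⟨t', ht', rfl⟩ := h'
  rw [InRing.unique S ht ht']

/-- The list `l` consists of the first symbols of `x`. -/
def IsHistory (x : X) (l : List ℕ) : Prop :=
  ∀ (i : ℕ) (hi : i < l.length), IsSymbol S x i l[i]

theorem isOpen_isHistory (l : List ℕ) : IsOpen {x | IsHistory S x l} := by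
  have h1 : {x | IsHistory S x l} =
      ⋂ i : Fin l.length, ⋃ t ∈ {t : ℕ | t.unpair.1 = l[i]}, {x | InRing S x i t} := by
    ext x
    simp only [IsHistory, IsSymbol, Set.mem_ofPred_eq, Set.mem_iInter, Set.mem_iUnion, Fin.forall_iff,
      exists_prop]
    exact forall₂_congr fun i hi => exists_congr fun t => and_comm
  rw [h1]
  exact isOpen_iInter_of_finite fun i => isOpen_biUnion fun t _ => isOpen_inRing S i t

/-- In every nonempty open set one can prescribe a symbol freely: after some initial list of
symbols, every number occurs as the next symbol of a point of the set. -/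
theorem exists_history {O : Set X} (hO : IsOpen O) (hne : O.Nonempty) (T : ℕ) :
    ∃ l : List ℕ, T ≤ l.length ∧ ∀ v, ∃ x ∈ O, IsHistory S x (l ++ [v]) := by
  classical
  let F : Set X := S.α '' {m | m < T}
  have hF : F.Finite := (Set.finite_lt_nat T).image _
  have hex : ∃ i, S.α i ∈ O ∧ S.α i ∉ F := exists_mem_ball_ne S hO hne hF
  -- The first point of the dense sequence in `O \ F` differs from all earlier points.
  obtain ⟨hiO, hiF⟩ := Nat.find_spec hex
  have hmin := fun j => Nat.find_min hex (m := j)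
  generalize Nat.find hex = i at hiO hiF hmin
  have hTi : T ≤ i := by
    by_contra hlt
    exact hiF ⟨i, not_le.1 hlt, rfl⟩
  have hsym : ∀ j, ∃ v, j < i → IsSymbol S (S.α i) j v := fun j => by
    by_cases hj : j < i
    · have hd : S.α i ≠ S.α j := fun he => hmin j hj (he ▸ ⟨hiO, hiF⟩)
      obtain ⟨t, ht⟩ := exists_inRing S hd
      exact ⟨_, fun _ => ⟨t, ht, rfl⟩⟩
    · exact ⟨0, fun h => absurd h hj⟩
  choose f hf using hsym
  refine ⟨(List.range i).map f, by simpa using hTi, fun v => ?_⟩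
  have hhist : IsHistory S (S.α i) ((List.range i).map f) := fun j hj => by
    have : j < i := by simpa using hj
    simpa using hf j this
  obtain ⟨ε, hε, hball⟩ := Metric.isOpen_iff.1
    (hO.inter (isOpen_isHistory S ((List.range i).map f))) (S.α i) ⟨hiO, hhist⟩
  obtain ⟨T₀, hT₀⟩ := ((tendsto_ringRadius S i).eventually (gt_mem_nhds hε)).exists
  -- A ring with symbol `v` about `α i` that lies inside the ball of radius `ε`.
  obtain ⟨t, ht⟩ : ∃ t, Nat.pair v (T₀ + 1) = t + 1 :=
    Nat.exists_eq_succ_of_ne_zero (by have := Nat.right_le_pair v (T₀ + 1); omega)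
  have hT₀t : T₀ ≤ t := by have := Nat.right_le_pair v (T₀ + 1); omega
  obtain ⟨n, hn1, hn2⟩ := exists_between_ringRadius S i t
  have hanti := (ringRadius_strictAnti S i).antitone
  obtain ⟨hnO, hnl⟩ := hball (hn2.trans_le ((hanti hT₀t).trans hT₀.le))
  refine ⟨S.α n, hnO, fun j hj => ?_⟩
  rcases Nat.lt_or_ge j ((List.range i).map f).length with h | h
  · rw [List.getElem_append_left h]
    exact hnl j h
  · obtain rfl : j = i := by simp at h hj; omega
    refine ⟨t + 1, ⟨hn1, fun t' ht' => hn2.trans_le (hanti (by omega))⟩, ?_⟩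
    simp [← ht]

end Rings

/-! ### Verifying symbols from approximations -/

section Verify

variable {X : Type*} [MetricSpace X] (S : ComputableMetric X)

/-- The pairs `(m, s)` with `α m` close to `x` and `s` large. -/
def nearFilter (x : X) : Filter (ℕ × ℕ) := comap S.α (𝓝 x) ×ˢ atTop

theorem tendsto_nearFilter_fst (x : X) :
    Tendsto (fun q : ℕ × ℕ => S.α q.1) (nearFilter S x) (𝓝 x) :=
  tendsto_comap.comp tendsto_fst

theorem tendsto_nearFilter_snd (x : X) :
    Tendsto (fun q : ℕ × ℕ => q.2) (nearFilter S x) atTop :=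
  tendsto_snd

theorem exists_of_eventually_nearFilter {x : X} {P : ℕ × ℕ → Prop}
    (h : ∀ᶠ q in nearFilter S x, P q) : ∃ m s, dist x (S.α m) < (1 / 2) ^ s ∧ P (m, s) := by
  obtain ⟨u, hu, v, hv, huv⟩ := mem_prod_iff.1 h
  obtain ⟨W, hW, hWu⟩ := mem_comap.1 hu
  obtain ⟨s, hs⟩ := (mem_atTop_sets.1 hv)
  obtain ⟨ε, hε, hball⟩ := Metric.mem_nhds_iff.1 hW
  obtain ⟨m, hm⟩ := S.dense.exists_dist_lt x
    (lt_min hε (by positivity : (0 : ℝ) < (1 / 2) ^ s))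
  refine ⟨m, s, hm.trans_le (min_le_right _ _), huv ⟨hWu (hball ?_), hs s le_rfl⟩⟩
  rw [Metric.mem_ball, dist_comm]
  exact hm.trans_le (min_le_left _ _)

theorem eventually_nearFilter {x : X} {P : ℕ × ℕ → Prop} (h : ∀ᶠ q in nearFilter S x, P q) :
    ∃ U, IsOpen U ∧ x ∈ U ∧ ∃ N, ∀ m s, S.α m ∈ U → N ≤ s → P (m, s) := by
  obtain ⟨u, hu, v, hv, huv⟩ := mem_prod_iff.1 h
  obtain ⟨W, hW, hWu⟩ := mem_comap.1 hu
  obtain ⟨N, hN⟩ := mem_atTop_sets.1 hv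
  obtain ⟨U, hUW, hU, hxU⟩ := mem_nhds_iff.1 hW
  exact ⟨U, hU, hxU, N, fun m s hm hs => huv ⟨hWu (hUW hm), hN s hs⟩⟩

theorem tendsto_nearFilter_half_pow (x : X) :
    Tendsto (fun q : ℕ × ℕ => (1 / 2 : ℝ) ^ q.2) (nearFilter S x) (𝓝 0) :=
  (tendsto_pow_atTop_nhds_zero_of_lt_one (by norm_num) (by norm_num)).comp
    (tendsto_nearFilter_snd S x)

theorem dist_le_distApprox (n m z : ℕ) :
    dist (S.α n) (S.α m) ≤ (distApprox S n m z + 2) * (1 / 2) ^ z := by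
  have h := dist_mul_le S n m z
  rw [div_pow, one_pow, mul_one_div, le_div_iff₀ (by positivity)]
  exact h

theorem distApprox_mul_le (n m z : ℕ) :
    distApprox S n m z * (1 / 2 : ℝ) ^ z ≤ dist (S.α n) (S.α m) + 2 * (1 / 2) ^ z := by
  calc distApprox S n m z * (1 / 2 : ℝ) ^ z
      ≤ (dist (S.α n) (S.α m) * 2 ^ z + 2) * (1 / 2) ^ z := by
        gcongr
        exact distApprox_le S n m z
    _ = dist (S.α n) (S.α m) * (2 ^ z * (1 / 2) ^ z) + 2 * (1 / 2) ^ z := by ring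
    _ = _ := by rw [← mul_pow]; norm_num

theorem le_distApprox_mul (n m z : ℕ) :
    dist (S.α n) (S.α m) - 2 * (1 / 2) ^ z ≤ distApprox S n m z * (1 / 2 : ℝ) ^ z := by
  have := dist_le_distApprox S n m z
  linarith

theorem tendsto_nearFilter_dist (x : X) (i : ℕ) :
    Tendsto (fun q : ℕ × ℕ => dist (S.α q.1) (S.α i)) (nearFilter S x) (𝓝 (dist x (S.α i))) :=
  (tendsto_nearFilter_fst S x).dist tendsto_const_nhds

variable [PerfectSpace X]

/-- Verifies that the ball about `α m` with radius `2 ^ (-s)` lies beyond the `t`-th radius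
about `α i`. -/
noncomputable def ringOutside (i t m s : ℕ) : Bool :=
  decide ((cut S s + 1) * 2 ^ s + 3 * (16 ^ s * 2 ^ ringExp S i t) ≤
    distApprox S m i s * (16 ^ s * 2 ^ ringExp S i t))

/-- Verifies that the ball about `α m` with radius `2 ^ (-s)` lies within the `t`-th radius
about `α i`. -/
noncomputable def ringInside (i t m s : ℕ) : Bool :=
  decide ((distApprox S m i s + 3) * (16 ^ s * 2 ^ ringExp S i t) ≤ cut S s * 2 ^ s)

theorem ringOutside_iff {i t m s : ℕ} : ringOutside S i t m s = true ↔
    ((cut S s : ℝ) + 1) / 16 ^ s * (1 / 2) ^ ringExp S i t + 3 * (1 / 2) ^ s ≤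
      distApprox S m i s * (1 / 2) ^ s := by
  unfold ringOutside
  generalize ringExp S i t = k
  have h1 : ((cut S s : ℝ) + 1) / 16 ^ s * (1 / 2) ^ k + 3 * (1 / 2) ^ s =
      ((cut S s + 1) * 2 ^ s + 3 * (16 ^ s * 2 ^ k)) / (16 ^ s * 2 ^ k * 2 ^ s) := by
    simp only [div_pow, one_pow]
    field_simp
  have h2 : (distApprox S m i s : ℝ) * (1 / 2) ^ s =
      distApprox S m i s * (16 ^ s * 2 ^ k) / (16 ^ s * 2 ^ k * 2 ^ s) := by
    simp only [div_pow, one_pow]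
    field_simp
  rw [h1, h2, div_le_div_iff_of_pos_right (by positivity), decide_eq_true_iff]
  exact_mod_cast Iff.rfl

theorem ringInside_iff {i t m s : ℕ} : ringInside S i t m s = true ↔
    ((distApprox S m i s : ℝ) + 3) * (1 / 2) ^ s ≤
      cut S s / 16 ^ s * (1 / 2) ^ ringExp S i t := by
  unfold ringInside
  generalize ringExp S i t = k
  have h1 : (cut S s : ℝ) / 16 ^ s * (1 / 2) ^ k =
      cut S s * 2 ^ s / (16 ^ s * 2 ^ k * 2 ^ s) := by
    simp only [div_pow, one_pow]
    field_simp
  have h2 : ((distApprox S m i s : ℝ) + 3) * (1 / 2) ^ s =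
      (distApprox S m i s + 3) * (16 ^ s * 2 ^ k) / (16 ^ s * 2 ^ k * 2 ^ s) := by
    simp only [div_pow, one_pow]
    field_simp
  rw [h1, h2, div_le_div_iff_of_pos_right (by positivity), decide_eq_true_iff]
  exact_mod_cast Iff.rfl

theorem ringRadius_lt_of_ringOutside {i t m s : ℕ} (h : ringOutside S i t m s = true) {x : X}
    (hx : dist x (S.α m) < (1 / 2) ^ s) : ringRadius S i t < dist x (S.α i) := by
  rw [ringOutside_iff] at h
  have h1 : ringRadius S i t ≤ ((cut S s : ℝ) + 1) / 16 ^ s * (1 / 2) ^ ringExp S i t :=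
    mul_le_mul_of_nonneg_right (genericRadius_lt S s).le (by positivity)
  have h2 := distApprox_mul_le S m i s
  have h3 := dist_triangle_left (S.α m) (S.α i) x
  linarith

theorem lt_ringRadius_of_ringInside {i t m s : ℕ} (h : ringInside S i t m s = true) {x : X}
    (hx : dist x (S.α m) < (1 / 2) ^ s) : dist x (S.α i) < ringRadius S i t := by
  rw [ringInside_iff] at h
  have h1 : (cut S s : ℝ) / 16 ^ s * (1 / 2) ^ ringExp S i t < ringRadius S i t :=
    mul_lt_mul_of_pos_right (cut_div_lt_genericRadius S s) (by positivity)
  have h2 := dist_le_distApprox S m i s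
  have h3 := dist_triangle x (S.α m) (S.α i)
  have h4 : (0 : ℝ) < (1 / 2) ^ s := by positivity
  linarith

theorem eventually_ringOutside {x : X} {i t : ℕ} (h : ringRadius S i t < dist x (S.α i)) :
    ∀ᶠ q in nearFilter S x, ringOutside S i t q.1 q.2 = true := by
  have h1 := (((tendsto_cut_succ S).comp (tendsto_nearFilter_snd S x)).mul_const
    ((1 / 2) ^ ringExp S i t)).add ((tendsto_nearFilter_half_pow S x).const_mul 5)
  rw [mul_zero, add_zero] at h1
  filter_upwards [h1.eventually_lt (tendsto_nearFilter_dist S x i) h] with q hq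
  rw [ringOutside_iff]
  have := le_distApprox_mul S q.1 i q.2
  simp only [Function.comp] at hq
  linarith

theorem eventually_ringInside {x : X} {i t : ℕ} (h : dist x (S.α i) < ringRadius S i t) :
    ∀ᶠ q in nearFilter S x, ringInside S i t q.1 q.2 = true := by
  have h1 := ((tendsto_cut S).comp (tendsto_nearFilter_snd S x)).mul_const
    ((1 / 2) ^ ringExp S i t)
  have h2 := (tendsto_nearFilter_dist S x i).add
    ((tendsto_nearFilter_half_pow S x).const_mul 5)
  rw [mul_zero, add_zero] at h2
  filter_upwards [h2.eventually_lt h1 h] with q hq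
  rw [ringInside_iff]
  have := distApprox_mul_le S q.1 i q.2
  simp only [Function.comp] at hq
  linarith

/-- The `i`-th symbol of all points in the ball about `α m` with radius `2 ^ (-s)`, if it can be
verified with precision `s`. -/
noncomputable def ballSymbol (m s i : ℕ) : Option ℕ :=
  (firstBelow (fun t => ringOutside S i t m s) s).elim none fun t =>
    bif decide (t = 0) || ringInside S i (t - 1) m s then some t.unpair.1 else none

@[fun_prop]
theorem computable_ringOutside {β : Type*} [Primcodable β] {f g h k : β → ℕ} (hf : Computable f)
    (hg : Computable g) (hh : Computable h) (hk : Computable k) :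
    Computable fun a => ringOutside S (f a) (g a) (h a) (k a) := by
  unfold ringOutside
  fun_prop

@[fun_prop]
theorem computable_ringInside {β : Type*} [Primcodable β] {f g h k : β → ℕ} (hf : Computable f)
    (hg : Computable g) (hh : Computable h) (hk : Computable k) :
    Computable fun a => ringInside S (f a) (g a) (h a) (k a) := by
  unfold ringInside
  fun_prop

@[fun_prop]
theorem computable_ballSymbol {β : Type*} [Primcodable β] {f g h : β → ℕ} (hf : Computable f)
    (hg : Computable g) (hh : Computable h) :
    Computable fun a => ballSymbol S (f a) (g a) (h a) := by
  unfold ballSymbol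
  exact computable_optionElim (computable_firstBelow (by fun_prop) (by fun_prop))
    (by fun_prop) (by fun_prop)

theorem isSymbol_of_ballSymbol {m s i v : ℕ} (h : ballSymbol S m s i = some v) {x : X}
    (hx : dist x (S.α m) < (1 / 2) ^ s) : IsSymbol S x i v := by
  unfold ballSymbol at h
  cases hf : firstBelow (fun t => ringOutside S i t m s) s with
  | none => simp [hf] at h
  | some t =>
    rw [hf, Option.elim] at h
    obtain ⟨-, hout, -⟩ := firstBelow_eq_some.1 hf
    cases hc : decide (t = 0) || ringInside S i (t - 1) m s with
    | false => simp [hc] at h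
    | true =>
      simp only [hc, cond_true, Option.some.injEq] at h
      refine ⟨t, ⟨ringRadius_lt_of_ringOutside S hout hx, fun t' ht' => ?_⟩, h⟩
      rcases Bool.or_eq_true_iff.1 hc with h0 | hin
      · have := decide_eq_true_iff.1 h0
        omega
      · exact (lt_ringRadius_of_ringInside S hin hx).trans_le
          ((ringRadius_strictAnti S i).antitone (by omega))

theorem eventually_ballSymbol {x : X} {i v : ℕ} (h : IsSymbol S x i v) :
    ∀ᶠ q in nearFilter S x, ballSymbol S q.1 q.2 i = some v := by
  obtain ⟨t, ⟨h1, h2⟩, rfl⟩ := h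
  have hin : ∀ᶠ q in nearFilter S x, t = 0 ∨ ringInside S i (t - 1) q.1 q.2 = true := by
    rcases Nat.eq_zero_or_pos t with h0 | h0
    · exact Eventually.of_forall fun _ => Or.inl h0
    · exact (eventually_ringInside S (h2 (t - 1) (by omega))).mono fun _ => Or.inr
  filter_upwards [eventually_ringOutside S h1, hin,
    (tendsto_nearFilter_snd S x).eventually (eventually_gt_atTop t)] with q hout hq hs
  have hfirst : firstBelow (fun t => ringOutside S i t q.1 q.2) q.2 = some t := by
    refine firstBelow_eq_some.2 ⟨hs, hout, fun t' ht' => ?_⟩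
    by_contra hne
    have ho' := ringRadius_lt_of_ringOutside S (Bool.not_eq_false _ ▸ hne)
      (x := S.α q.1) (by simp)
    have hi := lt_ringRadius_of_ringInside S (hq.resolve_left (by omega))
      (x := S.α q.1) (by simp)
    have := (ringRadius_strictAnti S i).antitone (by omega : t' ≤ t - 1)
    linarith
  have hcond : (decide (t = 0) || ringInside S i (t - 1) q.1 q.2) = true := by
    simpa using hq
  simp [ballSymbol, hfirst, hcond]

/-- The longest list of first symbols of all points in the ball about `α m` with radius
`2 ^ (-s)` that can be verified with precision `s`, cut off at length `s`. -/
noncomputable def ballHistory (m s : ℕ) : List ℕ := grow (ballSymbol S m s) s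

@[fun_prop]
theorem computable_ballHistory {β : Type*} [Primcodable β] {f g : β → ℕ} (hf : Computable f)
    (hg : Computable g) : Computable fun a => ballHistory S (f a) (g a) :=
  computable_grow (o := fun a => ballSymbol S (f a) (g a)) (by fun_prop) hg

theorem isHistory_ballHistory {m s : ℕ} {x : X} (hx : dist x (S.α m) < (1 / 2) ^ s) :
    IsHistory S x (ballHistory S m s) := fun _ hi =>
  isSymbol_of_ballSymbol S (grow_spec hi) hx

theorem eventually_prefix_ballHistory {x : X} {l : List ℕ} (h : IsHistory S x l) :
    ∀ᶠ q in nearFilter S x, l <+: ballHistory S q.1 q.2 := by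
  have h1 : ∀ᶠ q in nearFilter S x, ∀ i : Fin l.length,
      ballSymbol S q.1 q.2 i = some l[i] :=
    eventually_all.2 fun i => eventually_ballSymbol S (h i i.2)
  filter_upwards [h1, (tendsto_nearFilter_snd S x).eventually (eventually_ge_atTop l.length)]
    with q hq hs
  exact prefix_grow (fun i hi => hq ⟨i, hi⟩) hs

end Verify

/-! ### Points of the space from sequences of symbols -/

section Track

variable {X : Type*} [MetricSpace X] (S : ComputableMetric X)

/-- The ball `b'` is formally included in the ball `b`, where a pair `(c, e)` stands for the ball
about `α c` with radius `2 ^ (-e)`. -/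
def FormallyInside (b' b : ℕ × ℕ) : Prop :=
  dist (S.α b'.1) (S.α b.1) + (1 / 2) ^ b'.2 < (1 / 2 : ℝ) ^ b.2

theorem FormallyInside.trans {b b' b'' : ℕ × ℕ} (h : FormallyInside S b'' b')
    (h' : FormallyInside S b' b) : FormallyInside S b'' b := by
  unfold FormallyInside at *
  have := dist_triangle (S.α b''.1) (S.α b'.1) (S.α b.1)
  linarith

theorem FormallyInside.snd_lt {b b' : ℕ × ℕ} (h : FormallyInside S b' b) : b.2 < b'.2 := by
  unfold FormallyInside at h
  have h0 := dist_nonneg (x := S.α b'.1) (y := S.α b.1)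
  exact (pow_lt_pow_iff_right_of_lt_one₀ (a := (1 / 2 : ℝ)) (by norm_num) (by norm_num)).1
    (by linarith)

/-- A symbol `v = ⟨a, e⟩` proposes to move from the ball `b` to the ball about `α a` with radius
`2 ^ (-e)`. If this ball cannot be verified to be formally included in `b`, then the radius of
`b` is halved instead. -/
noncomputable def ballStep (b : ℕ × ℕ) (v : ℕ) : ℕ × ℕ :=
  bif decide ((distApprox S v.unpair.1 b.1 v.unpair.2 + 3) * 2 ^ b.2 < 2 ^ v.unpair.2) then
    v.unpair else (b.1, b.2 + 1)

theorem ballStep_condition {a c e k : ℕ} :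
    (distApprox S a c k + 3) * 2 ^ e < 2 ^ k ↔
      ((distApprox S a c k : ℝ) + 3) * (1 / 2) ^ k < (1 / 2) ^ e := by
  rw [div_pow, div_pow, one_pow, one_pow, mul_one_div, div_lt_div_iff₀ (by positivity)
    (by positivity), one_mul]
  exact_mod_cast Iff.rfl

theorem formallyInside_ballStep (b : ℕ × ℕ) (v : ℕ) : FormallyInside S (ballStep S b v) b := by
  unfold ballStep FormallyInside
  by_cases h : (distApprox S v.unpair.1 b.1 v.unpair.2 + 3) * 2 ^ b.2 < 2 ^ v.unpair.2
  · simp only [h, decide_true, cond_true]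
    rw [ballStep_condition] at h
    have := dist_le_distApprox S v.unpair.1 b.1 v.unpair.2
    linarith
  · simp only [h, decide_false, cond_false, dist_self, zero_add]
    exact pow_lt_pow_right_of_lt_one₀ (by norm_num) (by norm_num) (Nat.lt_succ_self _)

/-- Around every point of a ball there is an arbitrarily small ball that some symbol moves to. -/
theorem exists_ballStep {b : ℕ × ℕ} {y : X} (hy : dist y (S.α b.1) < (1 / 2) ^ b.2) {ε : ℝ}
    (hε : 0 < ε) : ∃ v : ℕ, ballStep S b v = v.unpair ∧ dist y (S.α v.unpair.1) < ε ∧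
      (1 / 2) ^ v.unpair.2 < ε := by
  set δ := min ε (((1 / 2) ^ b.2 - dist y (S.α b.1)) / 2) with hδ
  have hδ0 : 0 < δ := lt_min hε (by linarith)
  have hδ1 : δ ≤ ε := min_le_left _ _
  have hδ2 : δ ≤ ((1 / 2) ^ b.2 - dist y (S.α b.1)) / 2 := min_le_right _ _
  obtain ⟨k, hk⟩ := exists_pow_lt_of_lt_one (show 0 < δ / 5 by linarith)
    (show (1 / 2 : ℝ) < 1 by norm_num)
  obtain ⟨a, ha⟩ := S.dense.exists_dist_lt y hδ0
  have hc : (distApprox S a b.1 k + 3) * 2 ^ b.2 < 2 ^ k := by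
    rw [ballStep_condition]
    have h1 := distApprox_mul_le S a b.1 k
    have h2 := dist_triangle_left (S.α a) (S.α b.1) y
    linarith
  refine ⟨Nat.pair a k, ?_, ?_, ?_⟩
  · simp [ballStep, hc]
  · simpa using ha.trans_le hδ1
  · simp only [Nat.unpair_pair]
    linarith

/-- The balls that one passes through when one starts with the `n`-th ball and follows the
symbols `f 0, f 1, ...`. -/
noncomputable def track (f : ℕ → ℕ) (n : ℕ) : ℕ → ℕ × ℕ
  | 0 => n.unpair
  | k + 1 => ballStep S (track f n k) (f k)

theorem track_congr {f g : ℕ → ℕ} {n k : ℕ} (h : ∀ i < k, f i = g i) :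
    track S f n k = track S g n k := by
  induction k with
  | zero => rfl
  | succ k ih => simp only [track, ih fun i hi => h i (by omega), h k (by omega)]

theorem formallyInside_track (f : ℕ → ℕ) (n : ℕ) {k k' : ℕ} (h : k < k') :
    FormallyInside S (track S f n k') (track S f n k) := by
  induction k', h using Nat.le_induction with
  | base => exact formallyInside_ballStep S _ _
  | succ k' _ ih => exact (formallyInside_ballStep S _ _).trans S ih

theorem le_snd_track (f : ℕ → ℕ) (n k : ℕ) : k ≤ (track S f n k).2 := by
  induction k with
  | zero => exact Nat.zero_le _
  | succ k ih => exact ih.trans_lt (formallyInside_track S f n (Nat.lt_succ_self k)).snd_lt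

/-- The centres of the balls of a track form a Cauchy name of a point in all these balls. -/
theorem exists_track_limit [CompleteSpace X] (f : ℕ → ℕ) (n : ℕ) :
    ∃ y, CauchyName dist S.α (fun k => (track S f n k).1) y ∧
      ∀ k, dist y (S.α (track S f n k).1) < (1 / 2) ^ (track S f n k).2 := by
  have hin : ∀ {k k'}, k ≤ k' → dist (S.α (track S f n k').1) (S.α (track S f n k).1) <
      (1 / 2) ^ (track S f n k).2 := by
    intro k k' h
    rcases h.eq_or_lt with rfl | h
    · rw [dist_self]
      positivity
    · have h1 := formallyInside_track S f n h
      unfold FormallyInside at h1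
      have h2 : (0 : ℝ) < (1 / 2) ^ (track S f n k').2 := by positivity
      linarith
  have hpow : ∀ k, (1 / 2 : ℝ) ^ (track S f n k).2 ≤ (1 / 2) ^ k := fun k =>
    pow_le_pow_of_le_one (by norm_num) (by norm_num) (le_snd_track S f n k)
  have hcauchy : CauchySeq fun k => S.α (track S f n k).1 :=
    cauchySeq_of_le_tendsto_0' (fun k => (1 / 2 : ℝ) ^ k)
      (fun k k' h => by rw [dist_comm]; exact (hin h).le.trans (hpow k))
      (tendsto_pow_atTop_nhds_zero_of_lt_one (by norm_num) (by norm_num))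
  obtain ⟨y, hy⟩ := cauchySeq_tendsto_of_complete hcauchy
  refine ⟨y, ⟨tendsto_iff_dist_tendsto_zero.1 hy, fun k k' h => (hin h).trans_le (hpow k)⟩,
    fun k => ?_⟩
  have h1 : dist y (S.α (track S f n (k + 1)).1) ≤ (1 / 2) ^ (track S f n (k + 1)).2 :=
    le_of_tendsto (hy.dist tendsto_const_nhds)
      ((eventually_ge_atTop (k + 1)).mono fun k' h => (hin h).le)
  have h2 := formallyInside_track S f n (Nat.lt_succ_self k)
  unfold FormallyInside at h2
  have h3 := dist_triangle y (S.α (track S f n (k + 1)).1) (S.α (track S f n k).1)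
  linarith

@[fun_prop]
theorem computable_ballStep {β : Type*} [Primcodable β] {f : β → ℕ × ℕ} {g : β → ℕ}
    (hf : Computable f) (hg : Computable g) : Computable fun a => ballStep S (f a) (g a) := by
  unfold ballStep
  fun_prop

/-- The track along the symbols of a finite list. -/
noncomputable def listTrack (l : List ℕ) (n k : ℕ) : ℕ × ℕ := track S (fun i => l.getD i 0) n k

@[fun_prop]
theorem computable_listTrack {β : Type*} [Primcodable β] {f : β → List ℕ} {g h : β → ℕ}
    (hf : Computable f) (hg : Computable g) (hh : Computable h) :
    Computable fun a => listTrack S (f a) (g a) (h a) := by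
  have hrec : Computable fun a => (Nat.rec (g a).unpair (fun k b =>
      ballStep S b ((f a).getD k 0)) (h a) : ℕ × ℕ) :=
    computable_natRec (h := fun a k b => ballStep S b ((f a).getD k 0)) hh (by fun_prop)
      (by fun_prop)
  refine hrec.of_eq fun a => ?_
  unfold listTrack
  induction h a with
  | zero => rfl
  | succ k ih => simp only [track, ← ih]

theorem listTrack_eq_track {l : List ℕ} {f : ℕ → ℕ} {n k : ℕ}
    (h : ∀ (i : ℕ) (hi : i < l.length), l[i] = f i) (hk : k ≤ l.length) :
    listTrack S l n k = track S f n k :=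
  track_congr S fun i hi => by
    rw [List.getD_eq_getElem _ _ (lt_of_lt_of_le hi hk), h]

theorem listTrack_of_prefix {l l' : List ℕ} (h : l <+: l') {n k : ℕ} (hk : k ≤ l.length) :
    listTrack S l' n k = listTrack S l n k := by
  obtain ⟨t, rfl⟩ := h
  exact track_congr S fun i hi => by
    rw [List.getD_append _ _ _ _ (lt_of_lt_of_le hi hk)]

theorem listTrack_append_singleton (l : List ℕ) (v n : ℕ) :
    listTrack S (l ++ [v]) n (l.length + 1) = ballStep S (listTrack S l n l.length) v := by
  have h1 : listTrack S (l ++ [v]) n l.length = listTrack S l n l.length :=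
    listTrack_of_prefix S (List.prefix_append l [v]) le_rfl
  rw [← h1, listTrack, listTrack, track]
  simp

end Track

/-! ### Computable nets -/

section Net

variable {X : Type*} [MetricSpace X] (S : ComputableMetric X)

/-- Tests that `α m` is not close to any of the points `α c` with `c` in `l`. -/
noncomputable def netTest (s : ℕ) (l : List ℕ) (m : ℕ) : Bool :=
  !(firstBelow (fun t => decide (distApprox S m (l.getD t 0) (s + 5) ≤ 10)) l.length).isSome

/-- The numbers below `m` that the greedy algorithm selects for the net with precision `s`. -/
noncomputable def netList (s : ℕ) : ℕ → List ℕ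
  | 0 => []
  | m + 1 => bif netTest S s (netList s m) m then netList s m ++ [m] else netList s m

/-- Membership of the number `m` in the greedy net with precision `s`. -/
noncomputable def inNet (m s : ℕ) : Bool := netTest S s (netList S s m) m

@[fun_prop]
theorem computable_netTest {β : Type*} [Primcodable β] {f h : β → ℕ} {g : β → List ℕ}
    (hf : Computable f) (hg : Computable g) (hh : Computable h) :
    Computable fun a => netTest S (f a) (g a) (h a) := by
  unfold netTest
  exact computable_not (computable_isSome (computable_firstBelow (by fun_prop) (by fun_prop)))

@[fun_prop]
theorem computable_inNet {β : Type*} [Primcodable β] {f g : β → ℕ}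
    (hf : Computable f) (hg : Computable g) : Computable fun a => inNet S (f a) (g a) := by
  have hrec : Computable fun a => (Nat.rec ([] : List ℕ) (fun m l =>
      bif netTest S (g a) l m then l ++ [m] else l) (f a) : List ℕ) :=
    computable_natRec (h := fun a m l => bif netTest S (g a) l m then l ++ [m] else l) hf
      (by fun_prop) (by fun_prop)
  have hl : Computable fun a => netList S (g a) (f a) := by
    refine hrec.of_eq fun a => ?_
    induction f a with
    | zero => rfl
    | succ k ih => simp only [netList, ← ih]
  unfold inNet
  fun_prop

theorem netTest_eq_true {s m : ℕ} {l : List ℕ} :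
    netTest S s l m = true ↔ ∀ c ∈ l, 10 < distApprox S m c (s + 5) := by
  rw [netTest, Bool.not_eq_true', ← Bool.not_eq_true, firstBelow_isSome]
  simp only [decide_eq_true_eq, not_exists, not_and, not_le]
  constructor
  · intro h c hc
    obtain ⟨i, hi, rfl⟩ := List.mem_iff_getElem.1 hc
    simpa [hi] using h i hi
  · intro h i hi
    simpa [hi] using h _ (List.getElem_mem hi)

theorem mem_netList {s m c : ℕ} : c ∈ netList S s m ↔ c < m ∧ inNet S c s = true := by
  induction m with
  | zero => simp [netList]
  | succ m ih =>
    cases h : netTest S s (netList S s m) m with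
    | true =>
      simp only [netList, h, cond_true, List.mem_append, List.mem_singleton, ih]
      constructor
      · rintro (h1 | rfl)
        · exact ⟨by omega, h1.2⟩
        · exact ⟨by omega, h⟩
      · rintro ⟨h1, h2⟩
        rcases Nat.lt_succ_iff_lt_or_eq.1 h1 with h3 | h3
        · exact Or.inl ⟨h3, h2⟩
        · exact Or.inr h3
    | false =>
      simp only [netList, h, cond_false, ih]
      constructor
      · exact fun h1 => ⟨by omega, h1.2⟩
      · rintro ⟨h1, h2⟩
        rcases Nat.lt_succ_iff_lt_or_eq.1 h1 with h3 | rfl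
        · exact ⟨h3, h2⟩
        · rw [inNet, h] at h2
          exact absurd h2 (by simp)

theorem inNet_iff {m s : ℕ} : inNet S m s = true ↔
    ∀ c < m, inNet S c s = true → 10 < distApprox S m c (s + 5) := by
  rw [inNet, netTest_eq_true]
  simp only [mem_netList, and_imp]

theorem le_dist_of_inNet {m c s : ℕ} (hm : inNet S m s = true) (hc : inNet S c s = true)
    (hne : m ≠ c) : (1 / 4 : ℝ) * (1 / 2) ^ s ≤ dist (S.α m) (S.α c) := by
  have key : ∀ {m c : ℕ}, inNet S m s = true → inNet S c s = true → c < m →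
      (1 / 4 : ℝ) * (1 / 2) ^ s ≤ dist (S.α m) (S.α c) := by
    intro m c hm hc hlt
    have h1 : (11 : ℝ) ≤ distApprox S m c (s + 5) := by
      exact_mod_cast (inNet_iff S).1 hm c hlt hc
    have h2 := distApprox_mul_le S m c (s + 5)
    have h3 : (1 / 2 : ℝ) ^ (s + 5) = (1 / 2) ^ s / 32 := by rw [pow_add]; norm_num; ring
    rw [h3] at h2
    have h4 : (0 : ℝ) < (1 / 2) ^ s := by positivity
    nlinarith
  rcases lt_or_gt_of_ne hne with h | h
  · rw [dist_comm]
    exact key hc hm h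
  · exact key hm hc h

theorem exists_inNet (x : X) (s : ℕ) :
    ∃ m, inNet S m s = true ∧ dist x (S.α m) < (1 / 2) ^ s := by
  have hs : (0 : ℝ) < (1 / 2) ^ s := by positivity
  obtain ⟨m, hm⟩ := S.dense.exists_dist_lt x (half_pos hs)
  by_cases h : inNet S m s = true
  · exact ⟨m, h, by linarith⟩
  · rw [inNet_iff] at h
    push Not at h
    obtain ⟨c, -, hc, hle⟩ := h
    have h1 : (distApprox S m c (s + 5) : ℝ) ≤ 10 := by exact_mod_cast hle
    have h2 := dist_le_distApprox S m c (s + 5)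
    have h3 : (1 / 2 : ℝ) ^ (s + 5) = (1 / 2) ^ s / 32 := by rw [pow_add]; norm_num; ring
    rw [h3] at h2
    have h4 := dist_triangle x (S.α m) (S.α c)
    exact ⟨c, hc, by nlinarith⟩

/-- Points selected from the nets form a nowhere dense set if, near the points of a dense set,
only nets of bounded precision contribute. -/
theorem interior_closure_net_eq_empty [PerfectSpace X] {Q : ℕ × ℕ → Prop}
    (hQ : ∀ O : Set X, IsOpen O → O.Nonempty → ∃ x ∈ O, ∀ᶠ q in nearFilter S x, ¬ Q q) :
    interior (closure {x | ∃ m s, inNet S m s = true ∧ Q (m, s) ∧ S.α m = x}) = ∅ := by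
  set D := {x | ∃ m s, inNet S m s = true ∧ Q (m, s) ∧ S.α m = x} with hD
  by_contra hne
  obtain ⟨x, hx, hnear⟩ := hQ _ isOpen_interior (Set.nonempty_iff_ne_empty.2 hne)
  obtain ⟨U, hU, hxU, N, hN⟩ := eventually_nearFilter S hnear
  -- A ball so small that it contains at most one point of each of the remaining nets.
  set B := Metric.ball x ((1 / 8 : ℝ) * (1 / 2) ^ N) with hB
  have hxB : x ∈ B := Metric.mem_ball_self (by positivity)
  have hsub : ∀ s < N, {y | ∃ m, inNet S m s = true ∧ S.α m = y ∧ y ∈ B}.Subsingleton := by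
    rintro s hs _ ⟨m, hm, rfl, hmB⟩ _ ⟨c, hc, rfl, hcB⟩
    by_contra hmc
    have h1 := le_dist_of_inNet S hm hc fun h => hmc (by rw [h])
    have h2 := dist_triangle_right (S.α m) (S.α c) x
    have h3 : (1 / 2 : ℝ) ^ N ≤ (1 / 2) ^ s :=
      pow_le_pow_of_le_one (by norm_num) (by norm_num) hs.le
    rw [hB, Metric.mem_ball] at hmB hcB
    linarith
  have hfin : (⋃ s ∈ {s | s < N}, {y | ∃ m, inNet S m s = true ∧ S.α m = y ∧ y ∈ B}).Finite :=
    (Set.finite_lt_nat N).biUnion fun s hs => (hsub s hs).finite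
  set O := interior (closure D) ∩ (U ∩ B) with hO
  have hOo : IsOpen O := isOpen_interior.inter (hU.inter Metric.isOpen_ball)
  obtain ⟨n, hnO, hnF⟩ := exists_mem_ball_ne S hOo ⟨x, hx, hxU, hxB⟩ hfin
  obtain ⟨y, ⟨hyO, hyF⟩, m, s, hm, hq, rfl⟩ := mem_closure_iff.1 (interior_subset hnO.1) _
    (hOo.sdiff hfin.isClosed) ⟨hnO, hnF⟩
  refine hyF (Set.mem_biUnion (x := s) ?_ ⟨m, hm, rfl, hyO.2.2⟩)
  by_contra hs
  exact hN m s hyO.2.1 (not_lt.1 hs) hq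

end Net

/-! ### Decoding a dense sequence from a generic point -/

section Decode

variable {X : Type*} [MetricSpace X] (S : ComputableMetric X)

theorem CauchyName.dist_le {p : ℕ → ℕ} {x : X} (h : CauchyName dist S.α p x) (k : ℕ) :
    dist x (S.α (p k)) ≤ (1 / 2) ^ k := by
  have h1 : Tendsto (fun n => S.α (p n)) atTop (𝓝 x) := tendsto_iff_dist_tendsto_zero.2 h.1
  exact le_of_tendsto (h1.dist tendsto_const_nhds)
    ((eventually_ge_atTop k).mono fun n hn => (h.2 k n hn).le)

theorem CauchyName.dist_succ_lt {p : ℕ → ℕ} {x : X} (h : CauchyName dist S.α p x) (k : ℕ) :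
    dist x (S.α (p (k + 1))) < (1 / 2) ^ k :=
  (h.dist_le S (k + 1)).trans_lt
    (pow_lt_pow_right_of_lt_one₀ (by norm_num) (by norm_num) (Nat.lt_succ_self k))

theorem CauchyName.tendsto_nearFilter {p : ℕ → ℕ} {x : X} (h : CauchyName dist S.α p x) :
    Tendsto (fun z => (p (z + 1), z)) atTop (nearFilter S x) := by
  have h1 : Tendsto (fun n => S.α (p n)) atTop (𝓝 x) := tendsto_iff_dist_tendsto_zero.2 h.1
  have h2 : Tendsto (fun z => p (z + 1)) atTop (comap S.α (𝓝 x)) :=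
    tendsto_comap_iff.2 (h1.comp (tendsto_add_atTop_nat 1))
  exact h2.prodMk tendsto_id

variable [PerfectSpace X]

/-- A point that lies in balls with verified lists of symbols of every length has symbols of all
orders. -/
theorem exists_symbols {x : X}
    (h : ∀ i, ∃ m s, dist x (S.α m) < (1 / 2) ^ s ∧ i ≤ (ballHistory S m s).length) :
    ∃ f : ℕ → ℕ, ∀ i, IsSymbol S x i (f i) := by
  refine ⟨_, fun i => Classical.choose_spec (p := fun v => IsSymbol S x i v) ?_⟩
  obtain ⟨m, s, hx, hi⟩ := h (i + 1)
  exact ⟨_, isHistory_ballHistory S hx i hi⟩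

theorem listTrack_ballHistory {x : X} {f : ℕ → ℕ} (hf : ∀ i, IsSymbol S x i (f i)) {m s n k : ℕ}
    (hx : dist x (S.α m) < (1 / 2) ^ s) (hk : k ≤ (ballHistory S m s).length) :
    listTrack S (ballHistory S m s) n k = track S f n k :=
  listTrack_eq_track S (fun i hi => (isHistory_ballHistory S hx i hi).unique S (hf i)) hk

/-- A single machine computes the tracks of a generic point from every Cauchy name of it. -/
theorem exists_decoder : ∃ H : (ℕ → ℕ) →. (ℕ → ℕ), IsComputable H ∧
    ∀ (p : ℕ → ℕ) (x : X) (f : ℕ → ℕ), CauchyName dist S.α p x → (∀ i, IsSymbol S x i (f i)) →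
      (fun N : ℕ => (track S f N.unpair.1 N.unpair.2).1) ∈ H p := by
  let o : List ℕ → ℕ → Option ℕ := fun w N =>
    (firstBelow (fun z => decide (N.unpair.2 ≤ (ballHistory S (w.getD (z + 1) 0) z).length))
      (w.length - 1)).map fun z =>
        (listTrack S (ballHistory S (w.getD (z + 1) 0) z) N.unpair.1 N.unpair.2).1
  have hhist : Computable fun r : (List ℕ × ℕ) × ℕ =>
      ballHistory S (r.1.1.getD (r.2 + 1) 0) r.2 := by fun_prop
  have ho : Computable fun q : List ℕ × ℕ => o q.1 q.2 :=
    computable_optionMap (computable_firstBelow (P := fun (q : List ℕ × ℕ) z =>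
      decide (q.2.unpair.2 ≤ (ballHistory S (q.1.getD (z + 1) 0) z).length))
      (computable_decide_le (by fun_prop) (computable_length hhist)) (by fun_prop))
      (computable_fst (computable_listTrack S hhist (by fun_prop) (by fun_prop)))
  have hmono : ∀ u v N a, u <+: v → o u N = some a → o v N = some a := by
    rintro u v N a ⟨t, rfl⟩ h
    obtain ⟨z, hz, rfl⟩ := Option.map_eq_some_iff.1 h
    obtain ⟨h1, h2, h3⟩ := firstBelow_eq_some.1 hz
    have hget : ∀ z' ≤ z, (u ++ t).getD (z' + 1) 0 = u.getD (z' + 1) 0 := fun z' hz' =>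
      List.getD_append _ _ _ _ (by omega)
    refine Option.map_eq_some_iff.2 ⟨z, firstBelow_eq_some.2 ⟨?_, ?_, fun z' hz' => ?_⟩, ?_⟩
    · rw [List.length_append]
      omega
    · rw [hget z le_rfl]
      exact h2
    · rw [hget z' hz'.le]
      exact h3 z' hz'
    · rw [hget z le_rfl]
  obtain ⟨H, hH, hmem⟩ := exists_isComputable ho hmono
  refine ⟨H, hH, fun p x f hp hf => hmem p _ fun N => ?_⟩
  have hhist : IsHistory S x ((List.range N.unpair.2).map f) := fun i hi => by simpa using hf i
  have hex : ∃ z, N.unpair.2 ≤ (ballHistory S (p (z + 1)) z).length :=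
    (((hp.tendsto_nearFilter S).eventually (eventually_prefix_ballHistory S hhist)).mono
      fun z hz => by simpa using hz.length_le).exists
  refine ⟨Nat.find hex + 2, Option.map_eq_some_iff.2 ⟨Nat.find hex, ?_, ?_⟩⟩
  · refine firstBelow_eq_some.2 ⟨?_, ?_, fun z hz => ?_⟩
    · rw [pre_length]
      omega
    · rw [pre_getD p (by omega), decide_eq_true_iff]
      exact Nat.find_spec hex
    · rw [pre_getD p (by omega), decide_eq_false_iff_not]
      exact Nat.find_min hex hz
  · rw [pre_getD p (by omega),
      listTrack_ballHistory S hf (hp.dist_succ_lt S _) (Nat.find_spec hex)]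

/-- To reduce the dense version of the Baire category theorem to the original one, it suffices to
transform the given nowhere dense sets symbolwise into nowhere dense sets such that the tracks of
the points outside the new sets eventually avoid the given sets. -/
theorem strongReducible_of_transform [CompleteSpace X] (ρ : Representation (Closeds X))
    {g : ℕ → ℕ → ℕ} {φ : ℕ → ℕ} (hg : Computable fun q : ℕ × ℕ => g q.1 q.2)
    (hφ : Computable φ)
    (h : ∀ (p : ℕ → ℕ) (A : ℕ → Closeds X), ρ.seq.names p A → A ∈ nowhereDenseSeqs X →
      ∃ A' : ℕ → Closeds X, ρ.seq.names (fun N => g N (p (φ N))) A' ∧ A' ∈ nowhereDenseSeqs X ∧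
        ∀ x ∈ residue A', ∀ n i, ∃ m s, dist x (S.α m) < (1 / 2) ^ s ∧
          i ≤ (ballHistory S m s).length ∧
          ∀ y, dist y (S.α (listTrack S (ballHistory S m s) n (ballHistory S m s).length).1) <
            (1 / 2) ^ (listTrack S (ballHistory S m s) n (ballHistory S m s).length).2 →
              y ∉ A i) :
    StrongReducible
      { inRep := ρ.seq, outRep := (cauchyRep S).seq, dom := nowhereDenseSeqs X,
        val := denseSeqsIn : Problem (ℕ → Closeds X) (ℕ → X) }
      { inRep := ρ.seq, outRep := cauchyRep S, dom := nowhereDenseSeqs X,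
        val := residue : Problem (ℕ → Closeds X) X } := by
  obtain ⟨K, hK, hKmem⟩ := exists_isComputable_symbolwise hg hφ
  obtain ⟨H, hH, hHmem⟩ := exists_decoder S
  refine ⟨K, H, hK, hH, fun G hG p A hp hA => ?_⟩
  obtain ⟨A', hA'name, hA'dom, hres⟩ := h p A hp hA
  obtain ⟨q, hq, x, hx, hqx⟩ := hG _ A' hA'name hA'dom
  obtain ⟨f, hf⟩ := exists_symbols S (x := x) fun i => by
    obtain ⟨m, s, h1, h2, -⟩ := hres x hx 0 i
    exact ⟨m, s, h1, h2⟩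
  choose y hyname hyball using exists_track_limit S f
  refine ⟨fun N : ℕ => (track S f N.unpair.1 N.unpair.2).1, ?_, y,
    ⟨fun n => ?_, fun z _ => ?_⟩, fun n => ?_⟩
  · rw [PFun.comp_apply]
    refine Part.mem_bind_iff.2 ⟨q, ?_, hHmem q x f hqx hf⟩
    rw [PFun.comp_apply]
    exact Part.mem_bind_iff.2 ⟨_, hKmem p, hq⟩
  · rw [residue, Set.mem_compl_iff, Set.mem_iUnion, not_exists]
    intro i
    obtain ⟨m, s, h1, -, h3⟩ := hres x hx n i
    rw [listTrack_ballHistory S hf h1 le_rfl] at h3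
    exact h3 _ (hyball n _)
  · refine Metric.mem_closure_range_iff.2 fun ε hε => ?_
    obtain ⟨k, hk⟩ := exists_pow_lt_of_lt_one (half_pos hε) (show (1 / 2 : ℝ) < 1 by norm_num)
    obtain ⟨c, hc⟩ := S.dense.exists_dist_lt z (half_pos hε)
    refine ⟨Nat.pair c k, ?_⟩
    have h1 := hyball (Nat.pair c k) 0
    simp only [track, Nat.unpair_pair] at h1
    have h2 := dist_triangle_right z (y (Nat.pair c k)) (S.α c)
    linarith
  · have h1 := hyname n
    change CauchyName dist S.α
      (fun j => (track S f (Nat.pair n j).unpair.1 (Nat.pair n j).unpair.2).1) (y n)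
    simpa only [Nat.unpair_pair] using h1

/-- In every nonempty open set there is a point near which all verified tracks enter prescribed
small balls about a point outside a given nowhere dense set. -/
theorem exists_steering {A O : Set X} (hA : interior A = ∅) (hO : IsOpen O) (hne : O.Nonempty)
    (n i : ℕ) {P : X → ℝ → Prop} (hP : ∀ y ∉ A, ∃ ε > 0, P y ε) :
    ∃ x ∈ O, ∃ y ε, P y ε ∧ ∀ᶠ q in nearFilter S x, i ≤ (ballHistory S q.1 q.2).length ∧
      dist y (S.α (listTrack S (ballHistory S q.1 q.2) n (ballHistory S q.1 q.2).length).1) +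
        (1 / 2) ^ (listTrack S (ballHistory S q.1 q.2) n (ballHistory S q.1 q.2).length).2 <
          ε := by
  obtain ⟨l, hl, hv⟩ := exists_history S hO hne i
  set b := listTrack S l n l.length with hb
  obtain ⟨y, hyb, hyA⟩ : ∃ y, dist y (S.α b.1) < (1 / 2) ^ b.2 ∧ y ∉ A := by
    by_contra hcon
    push Not at hcon
    have hsub : Metric.ball (S.α b.1) ((1 / 2) ^ b.2) ⊆ interior A :=
      interior_maximal hcon Metric.isOpen_ball
    rw [hA] at hsub
    exact hsub (Metric.mem_ball_self (by positivity))
  obtain ⟨ε, hε, hPy⟩ := hP y hyA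
  obtain ⟨v, hstep, hv1, hv2⟩ := exists_ballStep S hyb (half_pos hε)
  obtain ⟨x, hxO, hx⟩ := hv v
  refine ⟨x, hxO, y, ε, hPy, (eventually_prefix_ballHistory S hx).mono fun q hq => ?_⟩
  generalize ballHistory S q.1 q.2 = l' at hq ⊢
  have hlen : l.length + 1 ≤ l'.length := by simpa using hq.length_le
  refine ⟨by omega, ?_⟩
  have hstart : listTrack S l' n (l.length + 1) = v.unpair := by
    rw [listTrack_of_prefix S hq (by simp), listTrack_append_singleton, ← hb, hstep]
  rcases hlen.eq_or_lt with heq | hlt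
  · rw [← heq, hstart]
    linarith
  · have h1 := formallyInside_track S (fun j => l'.getD j 0) n hlt
    change FormallyInside S (listTrack S l' n l'.length) (listTrack S l' n (l.length + 1)) at h1
    rw [hstart] at h1
    unfold FormallyInside at h1
    have h2 := dist_triangle_right y (S.α (listTrack S l' n l'.length).1) (S.α v.unpair.1)
    linarith

end Decode

/-! ### Negative information -/

section Negative

variable {X : Type*} [MetricSpace X] (S : ComputableMetric X)

/-- Verifies with precision `z` that the ball `b` is formally included in the `P`-th rational
ball. -/
noncomputable def insideRatBall (b : ℕ × ℕ) (P z : ℕ) : Bool :=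
  decide (((distApprox S b.1 P.unpair.1 z + 2) * 2 ^ b.2 + 2 ^ z) * (P.unpair.2.unpair.2 + 1) +
    P.unpair.2.unpair.1.unpair.2 * (2 ^ z * 2 ^ b.2) ≤
      P.unpair.2.unpair.1.unpair.1 * (2 ^ z * 2 ^ b.2))

@[fun_prop]
theorem computable_insideRatBall {β : Type*} [Primcodable β] {f : β → ℕ × ℕ} {g h : β → ℕ}
    (hf : Computable f) (hg : Computable g) (hh : Computable h) :
    Computable fun a => insideRatBall S (f a) (g a) (h a) := by
  unfold insideRatBall
  fun_prop

theorem insideRatBall_iff {b : ℕ × ℕ} {P z : ℕ} : insideRatBall S b P z = true ↔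
    ((distApprox S b.1 P.unpair.1 z : ℝ) + 2) * (1 / 2) ^ z + (1 / 2) ^ b.2 ≤
      ratEnum P.unpair.2 := by
  unfold insideRatBall ratEnum
  generalize distApprox S b.1 P.unpair.1 z = D
  generalize P.unpair.2.unpair.1.unpair.1 = u
  generalize P.unpair.2.unpair.1.unpair.2 = v
  generalize P.unpair.2.unpair.2 = c
  generalize b.2 = e
  have h1 : ((D : ℝ) + 2) * (1 / 2) ^ z + (1 / 2) ^ e =
      ((D + 2) * 2 ^ e + 2 ^ z) * (c + 1) / (2 ^ z * 2 ^ e * (c + 1)) := by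
    simp only [div_pow, one_pow]
    field_simp
  have h2 : ((((u : ℚ) - v) / (c + 1) : ℚ) : ℝ) =
      (u - v) * (2 ^ z * 2 ^ e) / (2 ^ z * 2 ^ e * (c + 1)) := by
    push_cast
    field_simp
  rw [h1, h2, div_le_div_iff_of_pos_right (by positivity), decide_eq_true_iff, sub_mul,
    le_sub_iff_add_le]
  exact_mod_cast Iff.rfl

theorem mem_ratBall_of_insideRatBall {b : ℕ × ℕ} {P z : ℕ} (h : insideRatBall S b P z = true)
    {y : X} (hy : dist y (S.α b.1) < (1 / 2) ^ b.2) : y ∈ ratBall S P := by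
  rw [insideRatBall_iff] at h
  have h1 := dist_le_distApprox S b.1 P.unpair.1 z
  have h2 := dist_triangle y (S.α b.1) (S.α P.unpair.1)
  rw [ratBall, Metric.mem_ball]
  linarith

theorem exists_insideRatBall {b : ℕ × ℕ} {P : ℕ}
    (h : dist (S.α b.1) (S.α P.unpair.1) + (1 / 2) ^ b.2 < ratEnum P.unpair.2) :
    ∃ z, insideRatBall S b P z = true := by
  obtain ⟨z, hz⟩ := exists_pow_lt_of_lt_one
    (show 0 < (ratEnum P.unpair.2 - (dist (S.α b.1) (S.α P.unpair.1) + (1 / 2) ^ b.2)) / 4 by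
      linarith) (show (1 / 2 : ℝ) < 1 by norm_num)
  refine ⟨z, (insideRatBall_iff S).2 ?_⟩
  have := distApprox_mul_le S b.1 P.unpair.1 z
  linarith

/-- The number of the rational ball about `α m` with radius `2 ^ (-s)`. -/
def ballCode (m s : ℕ) : ℕ := Nat.pair m (Nat.pair (Nat.pair 1 0) (2 ^ s - 1))

@[fun_prop]
theorem computable_ballCode {β : Type*} [Primcodable β] {f g : β → ℕ} (hf : Computable f)
    (hg : Computable g) : Computable fun a => ballCode (f a) (g a) := by
  unfold ballCode
  fun_prop

theorem ratBall_ballCode (m s : ℕ) :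
    ratBall S (ballCode m s) = Metric.ball (S.α m) ((1 / 2) ^ s) := by
  simp [ratBall, ballCode, ratEnum]

theorem ratBall_zero : ratBall S 0 = ∅ := by
  simp [ratBall, ratEnum]

variable [PerfectSpace X]

/-- The ball about `α m` with radius `2 ^ (-s)`, if it has a verified list of at least `i` symbols
and its `n`-th track is verified with precision `z` to end in the `P`-th ball; otherwise the empty
ball. -/
noncomputable def guardedBall (n i m s z P : ℕ) : ℕ :=
  bif decide (i ≤ (ballHistory S m s).length) && insideRatBall S
      (listTrack S (ballHistory S m s) n (ballHistory S m s).length) P z then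
    ballCode m s else 0

@[fun_prop]
theorem computable_guardedBall {β : Type*} [Primcodable β] {n i m s z P : β → ℕ}
    (hn : Computable n) (hi : Computable i) (hm : Computable m) (hs : Computable s)
    (hz : Computable z) (hP : Computable P) :
    Computable fun a => guardedBall S (n a) (i a) (m a) (s a) (z a) (P a) := by
  unfold guardedBall
  fun_prop

theorem mem_guardedBall {n i m s z P : ℕ} {x : X} :
    x ∈ ratBall S (guardedBall S n i m s z P) ↔ dist x (S.α m) < (1 / 2) ^ s ∧
      i ≤ (ballHistory S m s).length ∧
        insideRatBall S (listTrack S (ballHistory S m s) n (ballHistory S m s).length) P z =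
          true := by
  unfold guardedBall
  by_cases h : i ≤ (ballHistory S m s).length <;>
  cases insideRatBall S (listTrack S (ballHistory S m s) n (ballHistory S m s).length) P z <;>
  simp [h, ratBall_zero, ratBall_ballCode]

/-- The output symbol with number `⟨⟨n, i⟩, ⟨⟨m, s⟩, ⟨j, z⟩⟩⟩` of the transformation for negative
information, given the number `P` of the `j`-th ball in the complement of the `i`-th set. -/
noncomputable def negSymbol (N P : ℕ) : ℕ :=
  guardedBall S N.unpair.1.unpair.1 N.unpair.1.unpair.2 N.unpair.2.unpair.1.unpair.1
    N.unpair.2.unpair.1.unpair.2 N.unpair.2.unpair.2.unpair.2 P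

theorem computable_negSymbol : Computable fun q : ℕ × ℕ => negSymbol S q.1 q.2 := by
  unfold negSymbol
  fun_prop

theorem DBCT0_strongReducible_BCT0 [CompleteSpace X] :
    StrongReducible (DBCT0 S) (BCT0 S) := by
  refine strongReducible_of_transform S (negRep S) (g := negSymbol S)
    (φ := fun N => Nat.pair N.unpair.1.unpair.2 N.unpair.2.unpair.2.unpair.1)
    (computable_negSymbol S) (by fun_prop) fun p A hp hA => ?_
  set p' : ℕ → ℕ := fun N => negSymbol S N
    (p (Nat.pair N.unpair.1.unpair.2 N.unpair.2.unpair.2.unpair.1)) with hp'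
  have hopen : ∀ N, IsOpen (⋃ k, ratBall S (p' (Nat.pair N k))) := fun N =>
    isOpen_iUnion fun k => Metric.isOpen_ball
  have hmem : ∀ (n i : ℕ) (x : X), (∃ k, x ∈ ratBall S (p' (Nat.pair (Nat.pair n i) k))) ↔
      ∃ m s j z, dist x (S.α m) < (1 / 2) ^ s ∧ i ≤ (ballHistory S m s).length ∧
        insideRatBall S (listTrack S (ballHistory S m s) n (ballHistory S m s).length)
          (p (Nat.pair i j)) z = true := by
    intro n i x
    constructor
    · rintro ⟨k, hk⟩
      refine ⟨k.unpair.1.unpair.1, k.unpair.1.unpair.2, k.unpair.2.unpair.1,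
        k.unpair.2.unpair.2, ?_⟩
      simp only [hp', negSymbol, Nat.unpair_pair] at hk
      exact (mem_guardedBall S).1 hk
    · rintro ⟨m, s, j, z, h1, h2, h3⟩
      refine ⟨Nat.pair (Nat.pair m s) (Nat.pair j z), ?_⟩
      simp only [hp', negSymbol, Nat.unpair_pair]
      exact (mem_guardedBall S).2 ⟨h1, h2, h3⟩
  refine ⟨fun N => ⟨(⋃ k, ratBall S (p' (Nat.pair N k)))ᶜ, (hopen N).isClosed_compl⟩,
    fun N => rfl, fun N => ?_, fun x hx n i => ?_⟩
  · change interior (⋃ k, ratBall S (p' (Nat.pair N k)))ᶜ = ∅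
    obtain ⟨n, i, rfl⟩ : ∃ n i, N = Nat.pair n i := ⟨_, _, (Nat.pair_unpair N).symm⟩
    by_contra hne
    obtain ⟨x, hx, y, ε, ⟨j, rfl⟩, hnear⟩ := exists_steering S (hA i) isOpen_interior
      (Set.nonempty_iff_ne_empty.2 hne) n i
      (P := fun y ε => ∃ j, ε = ratEnum (p (Nat.pair i j)).unpair.2 -
        dist y (S.α (p (Nat.pair i j)).unpair.1)) fun y hy => by
          have hname : (A i : Set X) = (⋃ j, ratBall S (p (Nat.pair i j)))ᶜ := hp i
          rw [hname, Set.notMem_compl_iff, Set.mem_iUnion] at hy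
          obtain ⟨j, hj⟩ := hy
          rw [ratBall, Metric.mem_ball] at hj
          exact ⟨_, sub_pos.2 hj, j, rfl⟩
    obtain ⟨m, s, hms, hlen, hin⟩ := exists_of_eventually_nearFilter S hnear
    obtain ⟨z, hz⟩ := exists_insideRatBall S (P := p (Nat.pair i j))
      (b := listTrack S (ballHistory S m s) n (ballHistory S m s).length) (by
        have := dist_triangle_left (S.α (listTrack S (ballHistory S m s) n
          (ballHistory S m s).length).1) (S.α (p (Nat.pair i j)).unpair.1) y
        linarith)
    exact interior_subset hx (Set.mem_iUnion.2 ((hmem n i x).2 ⟨m, s, j, z, hms, hlen, hz⟩))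
  · have hx' : x ∈ ⋃ k, ratBall S (p' (Nat.pair (Nat.pair n i) k)) := by
      by_contra hcon
      exact hx (Set.mem_iUnion.2 ⟨Nat.pair n i, hcon⟩)
    obtain ⟨m, s, j, z, h1, h2, h3⟩ := (hmem n i x).1 (Set.mem_iUnion.1 hx')
    refine ⟨m, s, h1, h2, fun y hy hyA => ?_⟩
    have hname : (A i : Set X) = (⋃ j, ratBall S (p (Nat.pair i j)))ᶜ := hp i
    have hyA' : y ∈ (A i : Set X) := hyA
    rw [hname] at hyA'
    exact hyA' (Set.mem_iUnion.2 ⟨j, mem_ratBall_of_insideRatBall S h3 hy⟩)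

end Negative

/-! ### Positive information -/

section Positive

variable {X : Type*} [MetricSpace X] (S : ComputableMetric X)

/-- Since the point at infinity has distance `1` to all other points, a Cauchy name stays in one of
the two parts of the coproduct. -/
theorem CauchyName.eq_zero_iff {p : ℕ → ℕ} {x : X ⊕ Unit}
    (h : CauchyName coprodDist (coprodSeq S.α) p x) (k : ℕ) : p k = 0 ↔ x = .inr () := by
  obtain ⟨n, hn, hkn⟩ := ((h.1.eventually (gt_mem_nhds one_pos)).and
    (eventually_ge_atTop k)).exists
  have h1 := (h.2 k n hkn).trans_le (pow_le_one₀ (by norm_num) (by norm_num))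
  rcases x with x | x <;> cases hp : p k <;> cases hq : p n <;>
    simp_all [coprodDist, coprodSeq]

theorem CauchyName.pred {p : ℕ → ℕ} {x : X}
    (h : CauchyName coprodDist (coprodSeq S.α) p (.inl x)) :
    CauchyName dist S.α (fun k => p k - 1) x := by
  have hp : ∀ k, p k = p k - 1 + 1 := fun k => by
    have := (h.eq_zero_iff S k).not.2 (by simp)
    omega
  have hseq : ∀ k, coprodSeq S.α (p k) = .inl (S.α (p k - 1)) := fun k => by
    rw [hp k]
    rfl
  unfold CauchyName at h
  simp only [hseq] at h
  exact h

theorem cauchyName_const (a : ℕ) :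
    CauchyName coprodDist (coprodSeq S.α) (fun _ => a) (coprodSeq S.α a) := by
  have h : coprodDist (coprodSeq S.α a) (coprodSeq S.α a) = 0 := by
    cases a <;> simp [coprodSeq, coprodDist]
  refine ⟨by simp [h], fun k n _ => ?_⟩
  rw [h]
  positivity

/-- Verifies that the ball `b` contains the point of which `P` is the `k`-th symbol of a Cauchy
name in the coproduct. -/
noncomputable def meetsBall (b : ℕ × ℕ) (P k : ℕ) : Bool :=
  decide (0 < P) && decide ((distApprox S (P - 1) b.1 k + 3) * 2 ^ b.2 < 2 ^ k)

@[fun_prop]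
theorem computable_meetsBall {β : Type*} [Primcodable β] {f : β → ℕ × ℕ} {g h : β → ℕ}
    (hf : Computable f) (hg : Computable g) (hh : Computable h) :
    Computable fun a => meetsBall S (f a) (g a) (h a) := by
  unfold meetsBall
  fun_prop

theorem exists_meetsBall_iff {b : ℕ × ℕ} {p : ℕ → ℕ} {x : X ⊕ Unit}
    (h : CauchyName coprodDist (coprodSeq S.α) p x) :
    (∃ k, meetsBall S b (p k) k = true) ↔
      ∃ y, x = .inl y ∧ dist y (S.α b.1) < (1 / 2) ^ b.2 := by
  simp only [meetsBall, Bool.and_eq_true, decide_eq_true_eq, ballStep_condition]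
  constructor
  · rintro ⟨k, hk, hlt⟩
    rcases x with y | y
    · have h1 := (h.pred S).dist_le S k
      have h2 := dist_le_distApprox S (p k - 1) b.1 k
      have h3 := dist_triangle y (S.α (p k - 1)) (S.α b.1)
      exact ⟨y, rfl, by linarith⟩
    · exact absurd ((h.eq_zero_iff S k).2 rfl) hk.ne'
  · rintro ⟨y, rfl, hy⟩
    have hlim : Tendsto (fun k => dist (S.α (p k - 1)) (S.α b.1) + 5 * (1 / 2 : ℝ) ^ k) atTop
        (𝓝 (dist y (S.α b.1))) := by
      simpa using ((tendsto_iff_dist_tendsto_zero.2 (h.pred S).1).dist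
        (tendsto_const_nhds (x := S.α b.1))).add ((tendsto_pow_atTop_nhds_zero_of_lt_one
          (r := (1 / 2 : ℝ)) (by norm_num) (by norm_num)).const_mul 5)
    obtain ⟨k, hk⟩ := (hlim.eventually (gt_mem_nhds hy)).exists
    have h1 := distApprox_mul_le S (p k - 1) b.1 k
    exact ⟨k, Nat.pos_of_ne_zero ((h.eq_zero_iff S k).not.2 (by simp)), by linarith⟩

variable [PerfectSpace X]

/-- The point `α m` of the net with precision `s`, encoded as `m + 1`, if its verified list of
symbols is shorter than `i` or its `n`-th track is verified to end in a ball that contains the point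
with the `k`-th name symbol `P`; otherwise the point at infinity. -/
noncomputable def guardedPoint (n i m s k P : ℕ) : ℕ :=
  bif inNet S m s && (decide ((ballHistory S m s).length < i) ||
      meetsBall S (listTrack S (ballHistory S m s) n (ballHistory S m s).length) P k) then
    m + 1 else 0

@[fun_prop]
theorem computable_guardedPoint {β : Type*} [Primcodable β] {n i m s k P : β → ℕ}
    (hn : Computable n) (hi : Computable i) (hm : Computable m) (hs : Computable s)
    (hk : Computable k) (hP : Computable P) :
    Computable fun a => guardedPoint S (n a) (i a) (m a) (s a) (k a) (P a) := by
  unfold guardedPoint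
  fun_prop

theorem coprodSeq_guardedPoint {n i m s k P : ℕ} {x : X} :
    coprodSeq S.α (guardedPoint S n i m s k P) = .inl x ↔ inNet S m s = true ∧
      ((ballHistory S m s).length < i ∨ meetsBall S (listTrack S (ballHistory S m s) n
        (ballHistory S m s).length) P k = true) ∧ S.α m = x := by
  unfold guardedPoint
  by_cases h : (ballHistory S m s).length < i <;>
  cases inNet S m s <;>
  cases meetsBall S (listTrack S (ballHistory S m s) n (ballHistory S m s).length) P k <;>
  simp [h, coprodSeq]

/-- The output symbol with number `⟨⟨n, i⟩, ⟨⟨⟨m, s⟩, ⟨j, k⟩⟩, u⟩⟩` of the transformation for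
positive information, given the `k`-th symbol `P` of the name of the `j`-th point of the sequence
for the `i`-th set. It does not depend on `u`: the names of the points are constant. -/
noncomputable def posSymbol (N P : ℕ) : ℕ :=
  guardedPoint S N.unpair.1.unpair.1 N.unpair.1.unpair.2 N.unpair.2.unpair.1.unpair.1.unpair.1
    N.unpair.2.unpair.1.unpair.1.unpair.2 N.unpair.2.unpair.1.unpair.2.unpair.2 P

theorem computable_posSymbol : Computable fun q : ℕ × ℕ => posSymbol S q.1 q.2 := by
  unfold posSymbol
  fun_prop

theorem DBCT2_strongReducible_BCT2 [CompleteSpace X] :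
    StrongReducible (DBCT2 S) (BCT2 S) := by
  refine strongReducible_of_transform S (posRep S) (g := posSymbol S)
    (φ := fun N => Nat.pair N.unpair.1.unpair.2 N.unpair.2.unpair.1.unpair.2)
    (computable_posSymbol S) (by fun_prop) fun p A hp hA => ?_
  choose a ha hAa using hp
  -- The points of the new sets, coded as points of the coproduct.
  let w : ℕ → ℕ → X ⊕ Unit := fun N y => coprodSeq S.α
    (guardedPoint S N.unpair.1 N.unpair.2 y.unpair.1.unpair.1 y.unpair.1.unpair.2
      y.unpair.2.unpair.2 (p (Nat.pair N.unpair.2 y.unpair.2)))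
  let Q : ℕ → ℕ → ℕ × ℕ → Prop := fun n i q => (ballHistory S q.1 q.2).length < i ∨
    ∃ j y, a i j = .inl y ∧
      dist y (S.α (listTrack S (ballHistory S q.1 q.2) n (ballHistory S q.1 q.2).length).1) <
        (1 / 2) ^ (listTrack S (ballHistory S q.1 q.2) n (ballHistory S q.1 q.2).length).2
  have hname : ∀ i j, CauchyName coprodDist (coprodSeq S.α)
      (fun k => p (Nat.pair i (Nat.pair j k))) (a i j) := fun i j => ha i j
  have hw : ∀ n i, Sum.inl ⁻¹' closure (Set.range (w (Nat.pair n i))) =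
      closure {x | ∃ m s, inNet S m s = true ∧ Q n i (m, s) ∧ S.α m = x} := by
    intro n i
    rw [isOpenMap_inl.preimage_closure_eq_closure_preimage continuous_inl]
    congr 1
    ext x
    constructor
    · rintro ⟨y, hy⟩
      simp only [w, Nat.unpair_pair, coprodSeq_guardedPoint] at hy
      refine ⟨y.unpair.1.unpair.1, y.unpair.1.unpair.2, hy.1, ?_, hy.2.2⟩
      refine hy.2.1.imp id fun hm => ⟨y.unpair.2.unpair.1, ?_⟩
      refine (exists_meetsBall_iff S (hname i y.unpair.2.unpair.1)).1 ⟨y.unpair.2.unpair.2, ?_⟩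
      rw [Nat.pair_unpair]
      exact hm
    · rintro ⟨m, s, hm, hq, hx⟩
      obtain ⟨j, k, hjk⟩ : ∃ j k, (ballHistory S m s).length < i ∨ meetsBall S
          (listTrack S (ballHistory S m s) n (ballHistory S m s).length)
            (p (Nat.pair i (Nat.pair j k))) k = true := by
        rcases hq with h | ⟨j, hj⟩
        · exact ⟨0, 0, Or.inl h⟩
        · obtain ⟨k, hk⟩ := (exists_meetsBall_iff S (hname i j)).2 hj
          exact ⟨j, k, Or.inr hk⟩
      refine ⟨Nat.pair (Nat.pair m s) (Nat.pair j k), ?_⟩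
      simp only [w, Nat.unpair_pair, coprodSeq_guardedPoint]
      exact ⟨hm, hjk, hx⟩
  have hmemA : ∀ {i : ℕ} {j : ℕ} {y : X}, a i j = .inl y → y ∈ (A i : Set X) := by
    intro i j y h
    rw [hAa i]
    exact subset_closure ⟨j, h⟩
  have hwname : ∀ N y, CauchyName coprodDist (coprodSeq S.α) (fun u =>
      posSymbol S (Nat.pair N (Nat.pair y u)) (p (Nat.pair
        (Nat.pair N (Nat.pair y u)).unpair.1.unpair.2
        (Nat.pair N (Nat.pair y u)).unpair.2.unpair.1.unpair.2))) (w N y) := fun N y => by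
    simp only [posSymbol, Nat.unpair_pair]
    exact cauchyName_const S _
  refine ⟨fun N => ⟨Sum.inl ⁻¹' closure (Set.range (w N)),
    isClosed_closure.preimage continuous_inl⟩, fun N => ⟨w N, hwname N, rfl⟩, fun N => ?_,
    fun x hx n i => ?_⟩
  · change interior (Sum.inl ⁻¹' closure (Set.range (w N))) = ∅
    obtain ⟨n, i, rfl⟩ : ∃ n i, N = Nat.pair n i := ⟨_, _, (Nat.pair_unpair N).symm⟩
    rw [hw n i]
    refine interior_closure_net_eq_empty S fun O hO hne => ?_
    obtain ⟨x, hx, y, ε, hball, hnear⟩ := exists_steering S (hA i) hO hne n i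
      (P := fun y ε => Metric.ball y ε ⊆ (A i : Set X)ᶜ) fun y hy =>
        Metric.isOpen_iff.1 (A i).isClosed.isOpen_compl y hy
    refine ⟨x, hx, hnear.mono fun q hq hQ => ?_⟩
    rcases hQ with h | ⟨j, y', hj, hy'⟩
    · exact absurd hq.1 (not_le.2 h)
    · refine hball ?_ (hmemA hj)
      have h1 := dist_triangle_right y' y (S.α (listTrack S (ballHistory S q.1 q.2) n
        (ballHistory S q.1 q.2).length).1)
      rw [Metric.mem_ball]
      linarith [hq.2]
  · have hx' : x ∉ closure {x | ∃ m s, inNet S m s = true ∧ Q n i (m, s) ∧ S.α m = x} := by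
      rw [← hw n i]
      exact fun h => hx (Set.mem_iUnion.2 ⟨Nat.pair n i, h⟩)
    obtain ⟨ε, hε, hball⟩ := Metric.isOpen_iff.1 isClosed_closure.isOpen_compl x hx'
    obtain ⟨s, hs⟩ := exists_pow_lt_of_lt_one hε (show (1 / 2 : ℝ) < 1 by norm_num)
    obtain ⟨m, hm, hxm⟩ := exists_inNet S x s
    have hQ : ¬ Q n i (m, s) := fun h => by
      have hmem : S.α m ∈ Metric.ball x ε := by
        rw [Metric.mem_ball, dist_comm]
        exact hxm.trans hs
      exact hball hmem (subset_closure ⟨m, s, hm, h, rfl⟩)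
    obtain ⟨h1, h2⟩ := not_or.1 hQ
    refine ⟨m, s, hxm, not_lt.1 h1, fun y hy hyA => ?_⟩
    have hyA' : y ∈ (A i : Set X) := hyA
    rw [hAa i] at hyA'
    obtain ⟨_, ⟨z, hz, rfl⟩, j, hj⟩ := mem_closure_iff.1 hyA' _
      (isOpenMap_inl _ Metric.isOpen_ball) ⟨y, hy, rfl⟩
    exact h2 ⟨j, z, hj, hz⟩

end Positive

/-! ### The equivalences -/

/-- A point is obtained as the first member of a dense sequence. -/
theorem strongReducible_dense {X : Type*} [MetricSpace X] (S : ComputableMetric X)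
    (ρ : Representation (Closeds X)) :
    StrongReducible
      { inRep := ρ.seq, outRep := cauchyRep S, dom := nowhereDenseSeqs X,
        val := residue : Problem (ℕ → Closeds X) X }
      { inRep := ρ.seq, outRep := (cauchyRep S).seq, dom := nowhereDenseSeqs X,
        val := denseSeqsIn : Problem (ℕ → Closeds X) (ℕ → X) } := by
  obtain ⟨K, hK, hKmem⟩ := exists_isComputable_symbolwise (g := fun _ a => a) (φ := fun n => n)
    (by fun_prop) (by fun_prop)
  obtain ⟨H, hH, hHmem⟩ := exists_isComputable_symbolwise (g := fun _ a => a)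
    (φ := fun n => Nat.pair 0 n) (by fun_prop) (by fun_prop)
  refine ⟨K, H, hK, hH, fun G hG p A hp hA => ?_⟩
  obtain ⟨q, hq, x, hx, hqx⟩ := hG p A hp hA
  refine ⟨fun n => q (Nat.pair 0 n), ?_, x 0, hx.1 0, hqx 0⟩
  rw [PFun.comp_apply]
  refine Part.mem_bind_iff.2 ⟨q, ?_, hHmem q⟩
  rw [PFun.comp_apply]
  exact Part.mem_bind_iff.2 ⟨p, hKmem p, hq⟩

end BaireWeihrauch

theorem corollary7p3 {X : Type*} [MetricSpace X] [CompleteSpace X] [PerfectSpace X]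
    (S : BaireWeihrauch.ComputableMetric X) :
    BaireWeihrauch.StrongEquiv (BaireWeihrauch.DBCT0 S) (BaireWeihrauch.BCT0 S) ∧
      BaireWeihrauch.StrongEquiv (BaireWeihrauch.DBCT2 S) (BaireWeihrauch.BCT2 S) :=
  ⟨⟨BaireWeihrauch.DBCT0_strongReducible_BCT0 S,
      BaireWeihrauch.strongReducible_dense S (BaireWeihrauch.negRep S)⟩,
    ⟨BaireWeihrauch.DBCT2_strongReducible_BCT2 S,
      BaireWeihrauch.strongReducible_dense S (BaireWeihrauch.posRep S)⟩⟩
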